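/- **Setting.** Fix a set $V$ of values (used as data, data addresses and program points), a lattice of security labels with least (public) element $\bot$, a finite set of registers containing two distinct special ones, the stack pointer $r_{sp}$ and the temporary $r_{ret}$, and arbitrary functions giving the meaning of opcodes ($V^*\to V$), of branch conditions ($V^*\to\{\mathrm{true},\mathrm{false}\}$) and of address computation $\mathrm{addr}:V^*\to V$; two opcodes $succ$, $pred$ move the stack pointer. Values in registers and memory carry labels; the result of an operation carries the join of the labels of its operands. A program is a fixed partial map from program points to instructions: $op$, conditional branch, $load$, $store$, $fence$, indirect jump, $call$ and $ret$; operands are registers or labelled constants. No instruction of the program has $r_{ret}$ as an operand that it reads. A *configuration* $C=(\rho,\mu,n,buf)$ consists of a partial register map, a partial data memory, a program point and a reorder buffer, which is a partial map from $\mathbb N$ to transient instructions; it comes with a *return stack buffer* $\sigma$, a partial map from $\mathbb N$ to $\{\mathrm{push}\ m,\mathrm{pop}\}$, used only to predict return targets. $C$ is *initial* (equivalently, *terminal*) if $buf=\emptyset$. $C\approx C'$ means that $C$ and $C'$ have equal registers and equal memories, with labels; $C=C'$ means that all four components agree. In a buffer, an operand at index $i$ resolves to itself if it is a constant, and a register resolves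 to the value of its latest assignment at an index $<i$ (undefined if that assignment has no value yet), or to $\rho$ if there is no such assignment. A step is driven by one *directive*; it is possible only if the operands it uses resolve and the memory cells it reads are defined. Steps also emit observations (addresses read, written or forwarded, jump targets, rollbacks). * **Fetch** ($\mathsf{fetch}$, $\mathsf{fetch}:b$, $\mathsf{fetch}:m$). The transient form of the instruction at $n$ is put at $i=\max(\mathrm{dom}\,buf)+1$ (where $\max\emptyset=0$), and $n$ becomes the successor. For a branch the directive supplies the guessed outcome $b$, for an indirect jump the guessed target $m$; the guess is recorded in the entry. A call to $f$ with return point $p$ adds $\mathrm{call}$, $r_{sp}=succ(r_{sp})$ and $store(p,[r_{sp}])$ at $i,i+1,i+2$, sets $\sigma(i)=\mathrm{push}\ p$ and continues at $f$. A return adds $\mathrm{ret}$, $r_{ret}=load([r_{sp}])$, $r_{sp}=pred(r_{sp})$ and an indirect jump through $r_{ret}$ at $i,\dots,i+3$ and sets $\sigma(i)=\mathrm{pop}$; its guessed target is the top of the stack obtained by applying the entries of $\sigma$ in the order of their indices, or is supplied by the directive if that stack is empty. * **Execute** (always: no fence at an index $<i$). $\mathsf{execute}\ i$ evaluates an operation;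 or evaluates a branch or an indirect jump and replaces it by a resolved jump, where on a wrong guess all entries at indices $\ge i$ of $buf$ and of $\sigma$ are first deleted and $n$ becomes the correct target. For a load with address $a$, it takes the value from the latest store before $i$ whose address is resolved to $a$ (which must have a resolved value), recording the dependency on its index $j$, or from $\mu(a)$ with dependency $\bot$ if there is no such store. $\mathsf{execute}\ i:\mathsf{fwd}\ j$ gives an unresolved load at $i$ the resolved value $v$ of a store at $j<i$ before addresses are compared; a later $\mathsf{execute}\ i$ computes the address $a$ of the load. If the store is still at $j$, that step confirms the load if the store's address is unresolved or $a$ and no store strictly between $j$ and $i$ has resolved address $a$. If it has left the buffer, the step requires that no store before $i$ has resolved address $a$, and confirms the load (with dependency $\bot$) if $\mu(a)=v$ with label. Otherwise the step deletes all entries of $buf$ and $\sigma$ at indices $\ge i$ and sets $n$ to the program point of the load. $\mathsf{execute}\ i:\mathsf{value}$ and $\mathsf{execute}\ i:\mathsf{addr}$ resolve the value and the address $a$ of a store; if at some $k>i$ there is a resolved load with address $a_k$ and dependency $j_k$ such that $a_k=a$ and $j_k<i$ (where $\bot<i$), or $j_k=i$ and $a_k\ne a$, then for the least such $k$ all entries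 of $buf$ and $\sigma$ at indices $\ge k$ are deleted and $n$ becomes the program point of that load. * **Retire** ($\mathsf{retire}$). The entry with the least index, if fully resolved, is removed, and its effect is applied: an assignment to $\rho$, a store to $\mu$, none for a jump or a fence. The entries of a call, or of a return, are removed together; a call updates $r_{sp}$ and $\mu$, a return updates only $r_{sp}$. For a schedule (a finite list of directives) $D$, write $(C,\sigma)\Downarrow_D^N(C',\sigma')$ if executing $D$ takes $(C,\sigma)$ to $(C',\sigma')$ and $D$ contains exactly $N$ directives $\mathsf{retire}$; when this is possible, $D$ is *well-formed* for $C$. A *sequential execution* is an execution from an initial to a terminal configuration in which each fetch takes place when the reorder buffer is empty, that is, each fetched instruction is executed and retired before another one is fetched; write $\Downarrow^N_{seq}$ for sequential execution retiring $N$ instructions. **Theorem 1 (Equivalence to sequential execution).** Let $C$ be an initial configuration, with any return stack buffer $\sigma$, and let $D$ be a well-formed schedule with $(C,\sigma)\Downarrow_D^N(C_1,\sigma_1)$. Then there is a sequential execution $(C,\sigma)\Downarrow_{seq}^N(C_2,\sigma_2)$, and every such sequential execution satisfies $C_1\approx C_2$. Furthermore, if $C_1$ is terminal, then $C_1=C_2$.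 -/

import Mathlib

namespace Speculative

/-- Instruction operands: register names or labelled values (a value paired with its label). -/
inductive Operand (V L R : Type*) where
  | reg (r : R)
  | val (v : V × L)

/-- Physical instructions. `F` is the type of opcodes, `B` the type of branch conditions. -/
inductive Instr (V L R F B : Type*) where
  | op (f : F) (r : R) (args : List (Operand V L R)) (next : V)
  | br (b : B) (args : List (Operand V L R)) (nTrue nFalse : V)
  | load (r : R) (args : List (Operand V L R)) (next : V)
  | store (src : Operand V L R) (args : List (Operand V L R)) (next : V)
  | jmpi (args : List (Operand V L R))
  | call (target retPoint : V)
  | ret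
  | fence (next : V)

/-- The operands that occur in an instruction. -/
def Instr.operands {V L R F B : Type*} : Instr V L R F B → List (Operand V L R)
  | .op _ _ args _ => args
  | .br _ args _ _ => args
  | .load _ args _ => args
  | .store src args _ => src :: args
  | .jmpi args => args
  | .call _ _ => []
  | .ret => []
  | .fence _ => []

/-- The address part of a transient store: a list of operands until it is resolved, and then a
labelled address. -/
inductive StoreAddr (V L R : Type*) where
  | pending (args : List (Operand V L R))
  | resolved (a : V × L)

/-- Transient instructions. -/
inductive Trans (V L R F B : Type*) where
  /-- unresolved operation -/
  | op (f : F) (r : R) (args : List (Operand V L R))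
  /-- resolved operation `r = v` -/
  | val (r : R) (v : V × L)
  /-- unresolved conditional, predicted to go to `guess` -/
  | br (b : B) (args : List (Operand V L R)) (guess nTrue nFalse : V)
  /-- resolved jump -/
  | jump (n : V)
  /-- unresolved load, fetched at program point `pc` -/
  | load (r : R) (args : List (Operand V L R)) (pc : V)
  /-- partially resolved load, with the value `v` guessed to come from the store at index `j` -/
  | loadFwd (r : R) (args : List (Operand V L R)) (v : V × L) (j : ℕ) (pc : V)
  /-- resolved load `r = v {dep, a}`: address `a`, value from the store at index `dep`, or from
  memory if `dep = ⊥` -/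
  | loadVal (r : R) (v : V × L) (dep : WithBot ℕ) (a : V) (pc : V)
  /-- store; its source is resolved when it is a value -/
  | store (src : Operand V L R) (addr : StoreAddr V L R)
  /-- indirect jump, predicted to go to `guess` -/
  | jmpi (args : List (Operand V L R)) (guess : V)
  | call
  | ret
  | fence

/-- The transient form of the instructions that have a single successor (for the program point
`pc`), together with that successor. -/
def Instr.simple {V L R F B : Type*} (pc : V) :
    Instr V L R F B → Option (Trans V L R F B × V)
  | .op f r args next => some (.op f r args, next)
  | .load r args next => some (.load r args pc, next)
  | .store src args next => some (.store src (.pending args), next)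
  | .fence next => some (.fence, next)
  | _ => none

/-- The register that a transient instruction assigns. -/
def Trans.dest {V L R F B : Type*} : Trans V L R F B → Option R
  | .op _ r _ => some r
  | .val r _ => some r
  | .load r _ _ => some r
  | .loadFwd r _ _ _ _ => some r
  | .loadVal r _ _ _ _ => some r
  | _ => none

/-- The value that a transient instruction supplies to later instructions, if it has one. -/
def Trans.value {V L R F B : Type*} : Trans V L R F B → Option (V × L)
  | .val _ v => some v
  | .loadFwd _ _ v _ _ => some v
  | .loadVal _ v _ _ _ => some v
  | _ => none

/-- `t` is a fully resolved assignment `r = v`. -/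
inductive Trans.IsVal {V L R F B : Type*} (r : R) (v : V × L) : Trans V L R F B → Prop
  | val : Trans.IsVal r v (.val r v)
  | loadVal (dep : WithBot ℕ) (a pc : V) : Trans.IsVal r v (.loadVal r v dep a pc)

/-- `t` is a store whose address is resolved to `a`. -/
def Trans.StoresTo {V L R F B : Type*} (a : V) (t : Trans V L R F B) : Prop :=
  ∃ src l, t = .store src (.resolved (a, l))

/-- `t` is a resolved load that conflicts with the store at the earlier index `i` having address
`a`, and `pc` is its program point. -/
inductive Trans.Hazard {V L R F B : Type*} (i : ℕ) (a : V) (pc : V) : Trans V L R F B → Prop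
  | stale (r : R) (v : V × L) (dep : WithBot ℕ) : dep < (i : WithBot ℕ) →
      Trans.Hazard i a pc (.loadVal r v dep a pc)
  | misforward (r : R) (v : V × L) (a' : V) : a' ≠ a →
      Trans.Hazard i a pc (.loadVal r v (i : WithBot ℕ) a' pc)

/-- Reorder buffers: partial maps from indices to transient instructions. -/
abbrev Buf (V L R F B : Type*) := ℕ → Option (Trans V L R F B)

/-- Entries of the return stack buffer. -/
inductive RsbOp (V : Type*) where
  | push (n : V)
  | pop

/-- Return stack buffers. -/
abbrev Rsb (V : Type*) := ℕ → Option (RsbOp V)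

/-- The smallest index in the domain of a map (`0` if there is none). -/
noncomputable def minIdx {α : Type*} (m : ℕ → Option α) : ℕ := sInf {i | m i ≠ none}

/-- The largest index in the domain of a map (`0` if there is none). -/
noncomputable def maxIdx {α : Type*} (m : ℕ → Option α) : ℕ := sSup {i | m i ≠ none}

/-- The index of the next entry. -/
noncomputable def fresh {α : Type*} (m : ℕ → Option α) : ℕ := maxIdx m + 1

/-- `m[i ↦ x]` -/
def insert {α : Type*} (m : ℕ → Option α) (i : ℕ) (x : α) : ℕ → Option α :=
  Function.update m i (some x)

/-- `m` without index `i`. -/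
def erase {α : Type*} (m : ℕ → Option α) (i : ℕ) : ℕ → Option α :=
  Function.update m i none

/-- `m[j : j < i]` -/
def before {α : Type*} (m : ℕ → Option α) (i : ℕ) : ℕ → Option α :=
  fun j => if j < i then m j else none

/-- `m[j : j > i]` -/
def after {α : Type*} (m : ℕ → Option α) (i : ℕ) : ℕ → Option α :=
  fun j => if i < j then m j else none

/-- The effect of an entry of the return stack buffer on the stack of predicted return points
(its top is the head of the list). -/
def RsbOp.apply {V : Type*} (st : List V) : RsbOp V → List V
  | .push n => n :: st
  | .pop => st.tail

/-- The stack of predicted return points: all entries applied in the order of their indices. -/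
noncomputable def Rsb.stack {V : Type*} (σ : Rsb V) : List V :=
  ((List.range (maxIdx σ + 1)).filterMap σ).foldl RsbOp.apply []

/-- The predicted return point, if there is one. -/
noncomputable def Rsb.top {V : Type*} (σ : Rsb V) : Option V := σ.stack.head?

/-- Configurations: registers, data memory, current program point, reorder buffer. -/
structure Config (V L R F B : Type*) where
  reg : R → Option (V × L)
  mem : V → Option (V × L)
  pc : V
  buf : Buf V L R F B

/-- A configuration together with the return stack buffer. -/
structure State (V L R F B : Type*) where
  cfg : Config V L R F B
  rsb : Rsb V

/-- Initial (or terminal) configurations: the reorder buffer is empty. -/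
def Config.Terminal {V L R F B : Type*} (C : Config V L R F B) : Prop := ∀ i, C.buf i = none

/-- Equality of registers and memories. -/
def Config.Equiv {V L R F B : Type*} (C C' : Config V L R F B) : Prop :=
  C.reg = C'.reg ∧ C.mem = C'.mem

/-- What the semantics is parametric in: the meaning of opcodes, of branch conditions and of
address operands, the two opcodes that move the stack pointer, the stack pointer register and the
temporary register for return addresses. -/
structure Machine (V R F B : Type*) where
  evalOp : F → List V → V
  evalCond : B → List V → Bool
  addr : List V → V
  succ : F
  pred : F
  rsp : R
  rret : R
  rsp_ne_rret : rsp ≠ rret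

/-- Programs: partial maps from program points to instructions. -/
abbrev Program (V L R F B : Type*) := V → Option (Instr V L R F B)

/-- Attacker directives. -/
inductive Directive (V : Type*) where
  | fetch
  | fetchBranch (b : Bool)
  | fetchTarget (n : V)
  | execute (i : ℕ)
  | executeValue (i : ℕ)
  | executeAddr (i : ℕ)
  | executeFwd (i j : ℕ)
  | retire

/-- The three kinds of directives that fetch. -/
def Directive.IsFetch {V : Type*} : Directive V → Prop
  | .fetch => True
  | .fetchBranch _ => True
  | .fetchTarget _ => True
  | _ => False

/-- The number of `retire` directives in a schedule. -/
def numRetired {V : Type*} : List (Directive V) → ℕ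
  | [] => 0
  | .retire :: D => numRetired D + 1
  | _ :: D => numRetired D

/-- Observations. -/
inductive Obs (V L : Type*) where
  | read (a : V × L)
  | fwd (a : V × L)
  | write (a : V × L)
  | jump (n : V × L)
  | rollback

section Semantics

variable {V L R F B : Type*} [DecidableEq V] [DecidableEq R] [Lattice L] [OrderBot L]

/-- The register resolve function: the value of the latest assignment to `r` before index `i`
(undefined if it has no value yet), or that of the register map if there is no such assignment. -/
def resolveReg (buf : Buf V L R F B) (ρ : R → Option (V × L)) : ℕ → R → Option (V × L)
  | 0, r => ρ r
  | i + 1, r =>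
    match buf i with
    | none => resolveReg buf ρ i r
    | some t => if t.dest = some r then t.value else resolveReg buf ρ i r

/-- The register resolve function on operands. -/
def resolve (buf : Buf V L R F B) (ρ : R → Option (V × L)) (i : ℕ) :
    Operand V L R → Option (V × L)
  | .reg r => resolveReg buf ρ i r
  | .val v => some v

/-- The register resolve function on lists of operands. -/
def resolveAll (buf : Buf V L R F B) (ρ : R → Option (V × L)) (i : ℕ)
    (args : List (Operand V L R)) : Option (List (V × L)) :=
  args.mapM (resolve buf ρ i)

/-- The values in a list of labelled values. -/
def vals (vs : List (V × L)) : List V := vs.map Prod.fst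

/-- The join of the labels in a list of labelled values; the bottom label is the public one. -/
def lub (vs : List (V × L)) : L := (vs.map Prod.snd).foldr (· ⊔ ·) ⊥

/-- No fence before index `i`. -/
def NoFence (buf : Buf V L R F B) (i : ℕ) : Prop := ∀ j < i, buf j ≠ some .fence

/-- No store to address `a` at the indices `j` with `lo ≤ j < i`. -/
def NoStore (buf : Buf V L R F B) (a : V) (lo i : ℕ) : Prop :=
  ∀ j t, lo ≤ j → j < i → buf j = some t → ¬ t.StoresTo a

/-- The four entries that fetching a return adds at the index `i`. -/
def retEntries (M : Machine V R F B) (buf : Buf V L R F B) (i : ℕ) (pc guess : V) :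
    Buf V L R F B :=
  insert (insert (insert (insert buf i .ret)
    (i + 1) (.load M.rret [.reg M.rsp] pc))
    (i + 2) (.op M.pred M.rsp [.reg M.rsp]))
    (i + 3) (.jmpi [.reg M.rret] guess)

/-- The small-step semantics: `Step M P S d o S'` is the step from `S` to `S'` under the directive
`d` with the observations `o`. -/
inductive Step (M : Machine V R F B) (P : Program V L R F B) :
    State V L R F B → Directive V → List (Obs V L) → State V L R F B → Prop
  | simple_fetch {ρ μ n buf σ} {I t n'}
      (hI : P n = some I) (ht : I.simple n = some (t, n')) :
      Step M P ⟨⟨ρ, μ, n, buf⟩, σ⟩ .fetch []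
        ⟨⟨ρ, μ, n', insert buf (fresh buf) t⟩, σ⟩
  | cond_fetch {ρ μ n buf σ} {f args nt nf} (b : Bool)
      (hI : P n = some (.br f args nt nf)) :
      Step M P ⟨⟨ρ, μ, n, buf⟩, σ⟩ (.fetchBranch b) []
        ⟨⟨ρ, μ, cond b nt nf, insert buf (fresh buf) (.br f args (cond b nt nf) nt nf)⟩, σ⟩
  | jmpi_fetch {ρ μ n buf σ} {args} (n' : V)
      (hI : P n = some (.jmpi args)) :
      Step M P ⟨⟨ρ, μ, n, buf⟩, σ⟩ (.fetchTarget n') []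
        ⟨⟨ρ, μ, n', insert buf (fresh buf) (.jmpi args n')⟩, σ⟩
  | call_fetch {ρ μ n buf σ} {nf nr} {i : ℕ}
      (hI : P n = some (.call nf nr)) (hi : i = fresh buf) :
      Step M P ⟨⟨ρ, μ, n, buf⟩, σ⟩ .fetch []
        ⟨⟨ρ, μ, nf, insert (insert (insert buf i .call)
            (i + 1) (.op M.succ M.rsp [.reg M.rsp]))
            (i + 2) (.store (.val (nr, ⊥)) (.pending [.reg M.rsp]))⟩,
          insert σ i (.push nr)⟩
  | ret_fetch_rsb {ρ μ n buf σ} {n'} {i : ℕ}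
      (hI : P n = some .ret) (htop : Rsb.top σ = some n') (hi : i = fresh buf) :
      Step M P ⟨⟨ρ, μ, n, buf⟩, σ⟩ .fetch []
        ⟨⟨ρ, μ, n', retEntries M buf i n n'⟩, insert σ i .pop⟩
  | ret_fetch_rsb_empty {ρ μ n buf σ} (n' : V) {i : ℕ}
      (hI : P n = some .ret) (htop : Rsb.top σ = none) (hi : i = fresh buf) :
      Step M P ⟨⟨ρ, μ, n, buf⟩, σ⟩ (.fetchTarget n') []
        ⟨⟨ρ, μ, n', retEntries M buf i n n'⟩, insert σ i .pop⟩
  | op_execute {ρ μ n buf σ} {i f r args vs}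
      (hb : buf i = some (.op f r args)) (hf : NoFence buf i)
      (hv : resolveAll buf ρ i args = some vs) :
      Step M P ⟨⟨ρ, μ, n, buf⟩, σ⟩ (.execute i) []
        ⟨⟨ρ, μ, n, insert buf i (.val r (M.evalOp f (vals vs), lub vs))⟩, σ⟩
  | cond_execute_correct {ρ μ n buf σ} {i f args n₀ nt nf vs}
      (hb : buf i = some (.br f args n₀ nt nf)) (hf : NoFence buf i)
      (hv : resolveAll buf ρ i args = some vs)
      (hn : cond (M.evalCond f (vals vs)) nt nf = n₀) :
      Step M P ⟨⟨ρ, μ, n, buf⟩, σ⟩ (.execute i) [.jump (n₀, lub vs)]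
        ⟨⟨ρ, μ, n, insert buf i (.jump n₀)⟩, σ⟩
  | cond_execute_incorrect {ρ μ n buf σ} {i f args n₀ nt nf vs n'}
      (hb : buf i = some (.br f args n₀ nt nf)) (hf : NoFence buf i)
      (hv : resolveAll buf ρ i args = some vs)
      (hn : cond (M.evalCond f (vals vs)) nt nf = n') (hne : n' ≠ n₀) :
      Step M P ⟨⟨ρ, μ, n, buf⟩, σ⟩ (.execute i) [.rollback, .jump (n', lub vs)]
        ⟨⟨ρ, μ, n', insert (before buf i) i (.jump n')⟩, before σ i⟩
  | jmpi_execute_correct {ρ μ n buf σ} {i args n₀ vs}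
      (hb : buf i = some (.jmpi args n₀)) (hf : NoFence buf i)
      (hv : resolveAll buf ρ i args = some vs) (hn : M.addr (vals vs) = n₀) :
      Step M P ⟨⟨ρ, μ, n, buf⟩, σ⟩ (.execute i) [.jump (n₀, lub vs)]
        ⟨⟨ρ, μ, n, insert buf i (.jump n₀)⟩, σ⟩
  | jmpi_execute_incorrect {ρ μ n buf σ} {i args n₀ vs n'}
      (hb : buf i = some (.jmpi args n₀)) (hf : NoFence buf i)
      (hv : resolveAll buf ρ i args = some vs) (hn : M.addr (vals vs) = n') (hne : n' ≠ n₀) :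
      Step M P ⟨⟨ρ, μ, n, buf⟩, σ⟩ (.execute i) [.rollback, .jump (n', lub vs)]
        ⟨⟨ρ, μ, n', insert (before buf i) i (.jump n')⟩, before σ i⟩
  | load_execute_nodep {ρ μ n buf σ} {i r args pc vs a v}
      (hb : buf i = some (.load r args pc)) (hf : NoFence buf i)
      (hv : resolveAll buf ρ i args = some vs) (ha : M.addr (vals vs) = a)
      (hs : NoStore buf a 0 i) (hm : μ a = some v) :
      Step M P ⟨⟨ρ, μ, n, buf⟩, σ⟩ (.execute i) [.read (a, lub vs)]
        ⟨⟨ρ, μ, n, insert buf i (.loadVal r v ⊥ a pc)⟩, σ⟩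
  | load_execute_forward {ρ μ n buf σ} {i r args pc vs a j v l}
      (hb : buf i = some (.load r args pc)) (hf : NoFence buf i)
      (hv : resolveAll buf ρ i args = some vs) (ha : M.addr (vals vs) = a)
      (hj : j < i) (hbj : buf j = some (.store (.val v) (.resolved (a, l))))
      (hs : NoStore buf a (j + 1) i) :
      Step M P ⟨⟨ρ, μ, n, buf⟩, σ⟩ (.execute i) [.fwd (a, lub vs)]
        ⟨⟨ρ, μ, n, insert buf i (.loadVal r v (j : WithBot ℕ) a pc)⟩, σ⟩
  | load_execute_guess {ρ μ n buf σ} {i r args pc j v sa}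
      (hb : buf i = some (.load r args pc)) (hf : NoFence buf i)
      (hj : j < i) (hbj : buf j = some (.store (.val v) sa)) :
      Step M P ⟨⟨ρ, μ, n, buf⟩, σ⟩ (.executeFwd i j) []
        ⟨⟨ρ, μ, n, insert buf i (.loadFwd r args v j pc)⟩, σ⟩
  | load_addr_ok {ρ μ n buf σ} {i r args pc vs a j v sa}
      (hb : buf i = some (.loadFwd r args v j pc)) (hf : NoFence buf i)
      (hv : resolveAll buf ρ i args = some vs) (ha : M.addr (vals vs) = a)
      (hbj : buf j = some (.store (.val v) sa))
      (hsa : ∀ a' l, sa = .resolved (a', l) → a' = a)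
      (hs : NoStore buf a (j + 1) i) :
      Step M P ⟨⟨ρ, μ, n, buf⟩, σ⟩ (.execute i) [.fwd (a, lub vs)]
        ⟨⟨ρ, μ, n, insert buf i (.loadVal r v (j : WithBot ℕ) a pc)⟩, σ⟩
  | load_addr_hazard {ρ μ n buf σ} {i r args pc vs a j v sa}
      (hb : buf i = some (.loadFwd r args v j pc)) (hf : NoFence buf i)
      (hv : resolveAll buf ρ i args = some vs) (ha : M.addr (vals vs) = a)
      (hbj : buf j = some (.store (.val v) sa))
      (hs : (∃ a' l, sa = .resolved (a', l) ∧ a' ≠ a) ∨ ¬ NoStore buf a (j + 1) i) :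
      Step M P ⟨⟨ρ, μ, n, buf⟩, σ⟩ (.execute i) [.rollback, .fwd (a, lub vs)]
        ⟨⟨ρ, μ, pc, before buf i⟩, before σ i⟩
  | load_mem_match {ρ μ n buf σ} {i r args pc vs a j v}
      (hb : buf i = some (.loadFwd r args v j pc)) (hf : NoFence buf i)
      (hv : resolveAll buf ρ i args = some vs) (ha : M.addr (vals vs) = a)
      (hbj : buf j = none) (hs : NoStore buf a 0 i) (hm : μ a = some v) :
      Step M P ⟨⟨ρ, μ, n, buf⟩, σ⟩ (.execute i) [.read (a, lub vs)]
        ⟨⟨ρ, μ, n, insert buf i (.loadVal r v ⊥ a pc)⟩, σ⟩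
  | load_mem_hazard {ρ μ n buf σ} {i r args pc vs a j v v'}
      (hb : buf i = some (.loadFwd r args v j pc)) (hf : NoFence buf i)
      (hv : resolveAll buf ρ i args = some vs) (ha : M.addr (vals vs) = a)
      (hbj : buf j = none) (hs : NoStore buf a 0 i) (hm : μ a = some v') (hne : v' ≠ v) :
      Step M P ⟨⟨ρ, μ, n, buf⟩, σ⟩ (.execute i) [.rollback, .read (a, lub vs)]
        ⟨⟨ρ, μ, pc, before buf i⟩, before σ i⟩
  | store_execute_value {ρ μ n buf σ} {i src sa v}
      (hb : buf i = some (.store src sa)) (hf : NoFence buf i)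
      (hv : resolve buf ρ i src = some v) :
      Step M P ⟨⟨ρ, μ, n, buf⟩, σ⟩ (.executeValue i) []
        ⟨⟨ρ, μ, n, insert buf i (.store (.val v) sa)⟩, σ⟩
  | store_addr_ok {ρ μ n buf σ} {i src args vs a}
      (hb : buf i = some (.store src (.pending args))) (hf : NoFence buf i)
      (hv : resolveAll buf ρ i args = some vs) (ha : M.addr (vals vs) = a)
      (hk : ∀ k t pc, i < k → buf k = some t → ¬ t.Hazard i a pc) :
      Step M P ⟨⟨ρ, μ, n, buf⟩, σ⟩ (.executeAddr i) [.fwd (a, lub vs)]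
        ⟨⟨ρ, μ, n, insert buf i (.store src (.resolved (a, lub vs)))⟩, σ⟩
  | store_addr_hazard {ρ μ n buf σ} {i src args vs a k t pc}
      (hb : buf i = some (.store src (.pending args))) (hf : NoFence buf i)
      (hv : resolveAll buf ρ i args = some vs) (ha : M.addr (vals vs) = a)
      (hik : i < k) (hbk : buf k = some t) (ht : t.Hazard i a pc)
      (hmin : ∀ k' t' pc', i < k' → k' < k → buf k' = some t' → ¬ t'.Hazard i a pc') :
      Step M P ⟨⟨ρ, μ, n, buf⟩, σ⟩ (.executeAddr i) [.rollback, .fwd (a, lub vs)]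
        ⟨⟨ρ, μ, pc, insert (before buf k) i (.store src (.resolved (a, lub vs)))⟩, before σ k⟩
  | value_retire {ρ μ n buf σ} {i t r v}
      (hi : minIdx buf = i) (hb : buf i = some t) (ht : t.IsVal r v) :
      Step M P ⟨⟨ρ, μ, n, buf⟩, σ⟩ .retire []
        ⟨⟨Function.update ρ r (some v), μ, n, erase buf i⟩, σ⟩
  | jump_retire {ρ μ n buf σ} {i n₀}
      (hi : minIdx buf = i) (hb : buf i = some (.jump n₀)) :
      Step M P ⟨⟨ρ, μ, n, buf⟩, σ⟩ .retire []
        ⟨⟨ρ, μ, n, erase buf i⟩, σ⟩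
  | fence_retire {ρ μ n buf σ} {i}
      (hi : minIdx buf = i) (hb : buf i = some .fence) :
      Step M P ⟨⟨ρ, μ, n, buf⟩, σ⟩ .retire []
        ⟨⟨ρ, μ, n, erase buf i⟩, σ⟩
  | store_retire {ρ μ n buf σ} {i v a l}
      (hi : minIdx buf = i) (hb : buf i = some (.store (.val v) (.resolved (a, l)))) :
      Step M P ⟨⟨ρ, μ, n, buf⟩, σ⟩ .retire [.write (a, l)]
        ⟨⟨ρ, Function.update μ a (some v), n, erase buf i⟩, σ⟩
  | call_retire {ρ μ n buf σ} {i t₁ vsp v a l}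
      (hi : minIdx buf = i) (hb : buf i = some .call)
      (hb₁ : buf (i + 1) = some t₁) (ht₁ : t₁.IsVal M.rsp vsp)
      (hb₂ : buf (i + 2) = some (.store (.val v) (.resolved (a, l)))) :
      Step M P ⟨⟨ρ, μ, n, buf⟩, σ⟩ .retire [.write (a, l)]
        ⟨⟨Function.update ρ M.rsp (some vsp), Function.update μ a (some v), n,
          after buf (i + 2)⟩, σ⟩
  | ret_retire {ρ μ n buf σ} {i t₁ v₁ t₂ v₂ n'}
      (hi : minIdx buf = i) (hb : buf i = some .ret)
      (hb₁ : buf (i + 1) = some t₁) (ht₁ : t₁.IsVal M.rret v₁)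
      (hb₂ : buf (i + 2) = some t₂) (ht₂ : t₂.IsVal M.rsp v₂)
      (hb₃ : buf (i + 3) = some (.jump n')) :
      Step M P ⟨⟨ρ, μ, n, buf⟩, σ⟩ .retire []
        ⟨⟨Function.update ρ M.rsp (some v₂), μ, n, after buf (i + 3)⟩, σ⟩

/-- Steps of a sequential execution: an instruction is fetched only when no instruction is in
flight, so that every earlier one has been executed and retired. -/
def SeqStep (M : Machine V R F B) (P : Program V L R F B) (S : State V L R F B)
    (d : Directive V) (o : List (Obs V L)) (S' : State V L R F B) : Prop :=
  Step M P S d o S' ∧ (d.IsFetch → S.cfg.Terminal)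

/-- Sequences of steps of a given kind, with their schedule and their observations. -/
inductive Steps (T : State V L R F B → Directive V → List (Obs V L) → State V L R F B → Prop) :
    State V L R F B → List (Directive V) → List (Obs V L) → State V L R F B → Prop
  | nil (S) : Steps T S [] [] S
  | cons {S S' S'' d o D O} : T S d o S' → Steps T S' D O S'' → Steps T S (d :: D) (o ++ O) S''

/-- `BigStep M P N S D O S'`: the schedule `D` takes `S` to `S'` with the observations `O`, and
retires `N` instructions. -/
def BigStep (M : Machine V R F B) (P : Program V L R F B) (N : ℕ) (S : State V L R F B)
    (D : List (Directive V)) (O : List (Obs V L)) (S' : State V L R F B) : Prop :=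
  Steps (Step M P) S D O S' ∧ numRetired D = N

/-- `SeqBigStep M P N S O S'`: a sequential execution that retires `N` instructions, from an
initial configuration to a terminal one. -/
def SeqBigStep (M : Machine V R F B) (P : Program V L R F B) (N : ℕ) (S : State V L R F B)
    (O : List (Obs V L)) (S' : State V L R F B) : Prop :=
  S.cfg.Terminal ∧ S'.cfg.Terminal ∧
    ∃ D, Steps (SeqStep M P) S D O S' ∧ numRetired D = N

end Semantics

end Speculative

/-!
The reorder buffer always holds a path of predicted instructions that runs ahead of an in-order
machine whose registers and memory are those of the configuration. The only entries whose values can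
become wrong are resolved loads, and the dependency recorded in such a load determines which stores
may still change its value: as long as no hazard is detected, the value is the one that memory will
hold when the load is the oldest entry. Fetching and executing extend, refine or cut back this path,
whereas each retirement is exactly one step of the in-order machine. Every in-order step is in turn
realised by a sequential execution of a single instruction. Since the in-order machine is
deterministic, all executions that retire `N` instructions end with the same registers and memory.
When nothing is in flight, the program point is also that of the in-order machine.
-/

namespace Speculative

section PartialMaps

variable {α : Type*} {m : ℕ → Option α} {i j : ℕ} {x : α}

@[simp]
theorem insert_self : insert m i x i = some x := Function.update_self ..

theorem insert_of_ne (h : j ≠ i) : insert m i x j = m j := Function.update_of_ne h ..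

theorem before_of_lt (h : j < i) : before m i j = m j := if_pos h

theorem before_of_le (h : i ≤ j) : before m i j = none := if_neg h.not_gt

theorem after_of_lt (h : i < j) : after m i j = m j := if_pos h

theorem after_of_le (h : j ≤ i) : after m i j = none := if_neg h.not_gt

theorem after_eq_some_iff : after m i j = some x ↔ i < j ∧ m j = some x := by
  simp [after]

theorem erase_minIdx (hi : minIdx m = i) : erase m i = after m i := by
  funext j
  obtain hj | rfl | hj := lt_trichotomy j i
  · have hmj : m j = none := not_not.mp (Nat.notMem_of_lt_sInf (hi.symm ▸ hj))
    exact (Function.update_of_ne hj.ne ..).trans (hmj.trans (after_of_le hj.le).symm)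
  · exact (Function.update_self ..).trans (after_of_le le_rfl).symm
  · exact (Function.update_of_ne hj.ne' ..).trans (after_of_lt hj).symm

/-- `m` with the entries of `l` put at the indices from `i` on. -/
def insertList {α : Type*} (m : ℕ → Option α) (i : ℕ) : List α → ℕ → Option α
  | [] => m
  | x :: l => insertList (insert m i x) (i + 1) l

theorem insertList_of_lt {l : List α} (h : j < i) : insertList m i l j = m j := by
  induction l generalizing m i with
  | nil => rfl
  | cons x l ih => exact (ih (Nat.lt_succ_of_lt h)).trans (insert_of_ne h.ne)

theorem insertList_add {l : List α} (hm : ∀ k, i ≤ k → m k = none) (k : ℕ) :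
    insertList m i l (i + k) = l[k]? := by
  induction l generalizing m i k with
  | nil => exact hm _ (Nat.le_add_right i k)
  | cons x l ih =>
    cases k with
    | zero => exact (insertList_of_lt i.lt_succ_self).trans insert_self
    | succ k =>
      rw [List.getElem?_cons_succ, Nat.add_comm k 1, ← Nat.add_assoc]
      refine ih (fun k hk => ?_) k
      rw [insert_of_ne (Nat.lt_of_succ_le hk).ne', hm k (Nat.le_of_succ_le hk)]

theorem fresh_eq_of_forall_lt {n : ℕ} (h : ∀ k, n < k → m k = none) (hn : m n ≠ none) :
    fresh m = n + 1 := by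
  have hg : IsGreatest {i | m i ≠ none} n :=
    ⟨hn, fun k hk => not_lt.mp fun hnk => hk (h k hnk)⟩
  rw [fresh, maxIdx, hg.csSup_eq]

theorem fresh_of_forall_eq_none (h : ∀ k, m k = none) : fresh m = 1 := by
  simp [fresh, maxIdx, h]

theorem minIdx_eq_of_forall_lt {n : ℕ} (h : ∀ k < n, m k = none) (hn : m n ≠ none) :
    minIdx m = n :=
  IsLeast.csInf_eq ⟨hn, fun k hk => not_lt.mp fun hkn => hk (h k hkn)⟩

end PartialMaps

section Operands

variable {V L R : Type*}

/-- The value of an operand under the register map `ρ`, with no instruction in flight. -/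
def Operand.eval (ρ : R → Option (V × L)) : Operand V L R → Option (V × L)
  | .reg r => ρ r
  | .val v => some v

/-- The values of a list of operands under the register map `ρ`, with no instruction in flight. -/
def evalAll (ρ : R → Option (V × L)) (args : List (Operand V L R)) : Option (List (V × L)) :=
  args.mapM (Operand.eval ρ)

variable {ρ ρ' : R → Option (V × L)}

theorem Operand.eval_mono {o : Operand V L R} {v : V × L}
    (h : ∀ r, o = .reg r → ∀ w, ρ r = some w → ρ' r = some w) (hv : o.eval ρ = some v) :
    o.eval ρ' = some v := by
  cases o with
  | reg r => exact h r rfl v hv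
  | val => exact hv

theorem evalAll_mono {args : List (Operand V L R)} {vs : List (V × L)}
    (h : ∀ r, .reg r ∈ args → ∀ w, ρ r = some w → ρ' r = some w)
    (hv : evalAll ρ args = some vs) : evalAll ρ' args = some vs := by
  induction args generalizing vs with
  | nil => exact hv
  | cons o args ih =>
    simp only [evalAll, List.mapM_cons, Option.bind_eq_bind, Option.bind_eq_some_iff,
      Option.pure_def, Option.some.injEq] at hv ⊢
    obtain ⟨v, ho, ws, hws, rfl⟩ := hv
    exact ⟨v, ho.symm ▸ Operand.eval_mono (fun r hr => h r (by simp [hr])) ho, ws,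
      ih (fun r hr => h r (List.mem_cons_of_mem o hr)) hws, rfl⟩

@[simp]
theorem evalAll_singleton_reg {r : R} {vs : List (V × L)} :
    evalAll ρ [.reg r] = some vs ↔ ∃ v, ρ r = some v ∧ vs = [v] := by
  cases h : ρ r <;> simp [evalAll, Operand.eval, h, eq_comm]

end Operands

section InOrder

/-- The state of the in-order semantics: registers, data memory and program point. -/
structure ArchState (V L R : Type*) where
  reg : R → Option (V × L)
  mem : V → Option (V × L)
  pc : V

variable {V L R F B : Type*}

/-- The in-order state of a configuration: the reorder buffer is forgotten. -/
def Config.arch (C : Config V L R F B) : ArchState V L R := ⟨C.reg, C.mem, C.pc⟩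

theorem Config.eq_of_arch_eq {C C' : Config V L R F B} (hC : C.Terminal) (hC' : C'.Terminal)
    (h : C.arch = C'.arch) : C = C' := by
  obtain ⟨_, _, _, buf⟩ := C
  obtain ⟨_, _, _, buf'⟩ := C'
  obtain rfl : buf = buf' := funext fun i => (hC i).trans (hC' i).symm
  cases h
  rfl

variable [DecidableEq V] [DecidableEq R] [Lattice L] [OrderBot L]

/-- One step of the in-order semantics, which executes an instruction at once. A call and a return
do the work of all their transient entries; in particular a return leaves `M.rret` alone. -/
inductive ArchStep (M : Machine V R F B) (P : Program V L R F B) :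
    ArchState V L R → ArchState V L R → Prop
  | op {ρ μ p f r args next vs} (hI : P p = some (.op f r args next))
      (hv : evalAll ρ args = some vs) :
      ArchStep M P ⟨ρ, μ, p⟩
        ⟨Function.update ρ r (some (M.evalOp f (vals vs), lub vs)), μ, next⟩
  | br {ρ μ p f args nt nf vs} (hI : P p = some (.br f args nt nf))
      (hv : evalAll ρ args = some vs) :
      ArchStep M P ⟨ρ, μ, p⟩ ⟨ρ, μ, cond (M.evalCond f (vals vs)) nt nf⟩
  | load {ρ μ p r args next vs v} (hI : P p = some (.load r args next))
      (hv : evalAll ρ args = some vs) (hm : μ (M.addr (vals vs)) = some v) :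
      ArchStep M P ⟨ρ, μ, p⟩ ⟨Function.update ρ r (some v), μ, next⟩
  | store {ρ μ p src args next vs v} (hI : P p = some (.store src args next))
      (hs : src.eval ρ = some v) (hv : evalAll ρ args = some vs) :
      ArchStep M P ⟨ρ, μ, p⟩ ⟨ρ, Function.update μ (M.addr (vals vs)) (some v), next⟩
  | jmpi {ρ μ p args vs} (hI : P p = some (.jmpi args)) (hv : evalAll ρ args = some vs) :
      ArchStep M P ⟨ρ, μ, p⟩ ⟨ρ, μ, M.addr (vals vs)⟩
  | call {ρ μ p nf nr v} (hI : P p = some (.call nf nr)) (hr : ρ M.rsp = some v) :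
      ArchStep M P ⟨ρ, μ, p⟩
        ⟨Function.update ρ M.rsp (some (M.evalOp M.succ (vals [v]), lub [v])),
          Function.update μ (M.addr [M.evalOp M.succ (vals [v])]) (some (nr, ⊥)), nf⟩
  | ret {ρ μ p v w} (hI : P p = some .ret) (hr : ρ M.rsp = some v)
      (hm : μ (M.addr (vals [v])) = some w) :
      ArchStep M P ⟨ρ, μ, p⟩
        ⟨Function.update ρ M.rsp (some (M.evalOp M.pred (vals [v]), lub [v])), μ,
          M.addr (vals [w])⟩
  | fence {ρ μ p next} (hI : P p = some (.fence next)) : ArchStep M P ⟨ρ, μ, p⟩ ⟨ρ, μ, next⟩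

variable {M : Machine V R F B} {P : Program V L R F B}

theorem ArchStep.deterministic {a b c : ArchState V L R} (hb : ArchStep M P a b)
    (hc : ArchStep M P a c) : b = c := by
  cases hb <;> cases hc <;> simp_all

/-- Runs of the in-order semantics of a given length. -/
inductive ArchRun (M : Machine V R F B) (P : Program V L R F B) :
    ℕ → ArchState V L R → ArchState V L R → Prop
  | zero (a) : ArchRun M P 0 a a
  | succ {N a b c} : ArchStep M P a b → ArchRun M P N b c → ArchRun M P (N + 1) a c

theorem ArchRun.deterministic {N : ℕ} {a b c : ArchState V L R} (hb : ArchRun M P N a b)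
    (hc : ArchRun M P N a c) : b = c := by
  induction hb with
  | zero => cases hc; rfl
  | succ h _ ih =>
    obtain _ | ⟨h', hr⟩ := hc
    obtain rfl := h.deterministic h'
    exact ih hr

end InOrder

section Resolve

variable {V L R F B : Type*} [DecidableEq R] {buf buf' : Buf V L R F B}
  {ρ ρ' : R → Option (V × L)} {i k : ℕ}

theorem resolve_eq_eval (o : Operand V L R) :
    resolve buf ρ i o = o.eval (resolveReg buf ρ i) := by
  cases o <;> rfl

theorem resolveAll_eq_evalAll (args : List (Operand V L R)) :
    resolveAll buf ρ i args = evalAll (resolveReg buf ρ i) args :=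
  congrArg (List.mapM · args) (funext resolve_eq_eval)

theorem resolveReg_congr (h : ∀ j < i, buf' j = buf j) :
    resolveReg buf' ρ i = resolveReg buf ρ i := by
  induction i with
  | zero => rfl
  | succ i ih =>
    funext r
    simp only [resolveReg, h i i.lt_succ_self, ih fun j hj => h j (hj.trans i.lt_succ_self)]

theorem resolveReg_of_none (h : ∀ j < i, buf j = none) : resolveReg buf ρ i = ρ := by
  induction i with
  | zero => rfl
  | succ i ih =>
    funext r
    simp only [resolveReg, h i i.lt_succ_self, ih fun j hj => h j (hj.trans i.lt_succ_self)]

theorem resolveReg_succ {t : Trans V L R F B} (h : buf i = some t) (r : R) :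
    resolveReg buf ρ (i + 1) r = if t.dest = some r then t.value else resolveReg buf ρ i r := by
  simp only [resolveReg, h]

theorem resolveReg_succ_of_isVal {t : Trans V L R F B} {r : R} {v : V × L} (h : buf i = some t)
    (ht : t.IsVal r v) : resolveReg buf ρ (i + 1) = Function.update (resolveReg buf ρ i) r v := by
  funext r'
  rw [resolveReg_succ h, Function.update_apply]
  cases ht <;> simp only [Trans.dest, Trans.value, Option.some.injEq, eq_comm]

theorem resolveReg_succ_of_dest_eq_none {t : Trans V L R F B} (h : buf i = some t)
    (ht : t.dest = none) : resolveReg buf ρ (i + 1) = resolveReg buf ρ i := by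
  funext r
  simp [resolveReg_succ h, ht]

theorem resolveReg_insert {u u' : Trans V L R F B} (hu : buf i = some u) (hd : u'.dest = u.dest)
    (hval : ∀ v, u.value = some v → u'.value = some v) {r : R} {v : V × L}
    (h : resolveReg buf ρ k r = some v) : resolveReg (insert buf i u') ρ k r = some v := by
  induction k with
  | zero => exact h
  | succ k ih =>
    obtain rfl | hk := eq_or_ne k i
    · rw [resolveReg_succ hu] at h
      rw [resolveReg_succ (t := u') insert_self, hd]
      split_ifs at h ⊢
      exacts [hval v h, ih h]
    · have hb : insert buf i u' k = buf k := insert_of_ne hk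
      simp only [resolveReg, hb] at h ⊢
      cases hbk : buf k with
      | none => exact ih (by simpa only [hbk] using h)
      | some t =>
        simp only [hbk] at h ⊢
        split_ifs at h ⊢
        exacts [h, ih h]

theorem resolveReg_after {m : ℕ} {r : R} (hk : m < k)
    (h : ρ' r = resolveReg buf ρ (m + 1) r ∨
      ∃ j t, m < j ∧ j < k ∧ buf j = some t ∧ t.dest = some r) :
    resolveReg (after buf m) ρ' k r = resolveReg buf ρ k r := by
  induction k, Nat.succ_le_of_lt hk using Nat.le_induction with
  | base =>
    rw [resolveReg_of_none fun j hj => after_of_le (Nat.lt_succ_iff.mp hj)]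
    refine h.resolve_right ?_
    rintro ⟨j, _, hmj, hjm, _⟩
    omega
  | succ k hmk ih =>
    have skip (hn : ∀ t, buf k = some t → t.dest ≠ some r) :
        resolveReg (after buf m) ρ' k r = resolveReg buf ρ k r := by
      refine ih hmk (h.imp_right ?_)
      rintro ⟨j, t, hmj, hjk, hb, hd⟩
      refine ⟨j, t, hmj, (Nat.lt_succ_iff_lt_or_eq.mp hjk).resolve_right ?_, hb, hd⟩
      rintro rfl
      exact hn t hb hd
    have hb : after buf m k = buf k := after_of_lt hmk
    simp only [resolveReg, hb]
    cases hbk : buf k with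
    | none => exact skip (by simp [hbk])
    | some t =>
      dsimp only
      split_ifs with hd
      · rfl
      · exact skip (by simp [hbk, hd])

end Resolve

section LoadDep

variable {V L R F B : Type*}

/-- The value `v` of a resolved load at index `i` with address `a` and dependency `dep` is the one
that memory will hold at `a` when the load is the oldest entry, as far as the resolved store
addresses tell. If the forwarding store has retired already, `dep` may be its former index. -/
inductive LoadDep (buf : Buf V L R F B) (μ : V → Option (V × L)) (i : ℕ) (a : V) (v : V × L) :
    WithBot ℕ → Prop
  | forwarded {j : ℕ} {sa} (hj : j < i) (hb : buf j = some (.store (.val v) sa))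
      (hsa : ∀ a' l, sa = .resolved (a', l) → a' = a) (hs : NoStore buf a (j + 1) i) :
      LoadDep buf μ i a v j
  | memory {dep : WithBot ℕ} (hm : μ a = some v) (hs : NoStore buf a 0 i)
      (hdep : ∀ k : ℕ, buf k ≠ none → dep < k) : LoadDep buf μ i a v dep

variable {buf buf' : Buf V L R F B} {μ : V → Option (V × L)} {i lo s : ℕ} {a : V} {v : V × L}
  {dep : WithBot ℕ}

theorem NoStore.congr (h : NoStore buf a lo i) (hb : ∀ j < i, buf' j = buf j) :
    NoStore buf' a lo i :=
  fun j t hlo hi hj => h j t hlo hi (hb j hi ▸ hj)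

theorem NoStore.drop (h : NoStore buf a lo i) : NoStore (after buf s) a lo i :=
  fun j t hlo hi hj => h j t hlo hi (after_eq_some_iff.mp hj).2

theorem LoadDep.of_noStore (hm : μ a = some v) (hs : NoStore buf a 0 i) :
    LoadDep buf μ i a v ⊥ :=
  .memory hm hs fun k _ => WithBot.bot_lt_coe k

theorem LoadDep.congr (h : LoadDep buf μ i a v dep) (hi : buf i ≠ none)
    (hb : ∀ j < i, buf' j = buf j) : LoadDep buf' μ i a v dep := by
  cases h with
  | forwarded hj hbj hsa hs => exact .forwarded hj (hb _ hj ▸ hbj) hsa (hs.congr hb)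
  | memory hm hs hdep =>
    refine .memory hm (hs.congr hb) fun k hk => ?_
    obtain hki | hik := lt_or_ge k i
    · exact hdep k (hb k hki ▸ hk)
    · exact (hdep i hi).trans_le (by exact_mod_cast hik)

theorem LoadDep.drop (h : LoadDep buf μ i a v dep)
    (hs : ∀ j ≤ s, ∀ src sa, buf j ≠ some (.store src sa)) :
    LoadDep (after buf s) μ i a v dep := by
  cases h with
  | forwarded hj hbj hsa hs' =>
    have hsj := not_le.mp fun hjs => hs _ hjs _ _ hbj
    exact .forwarded hj ((after_of_lt hsj).trans hbj) hsa hs'.drop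
  | memory hm hs' hdep =>
    refine .memory hm hs'.drop fun k hk => hdep k fun hbk => hk ?_
    simp [after, hbk]

theorem LoadDep.drop_store [DecidableEq V] {a₀ : V} {l : L} {v₀ : V × L}
    (h : LoadDep buf μ i a v dep) (hsi : s < i)
    (hs : ∀ j < s, ∀ src sa, buf j ≠ some (.store src sa))
    (hb : buf s = some (.store (.val v₀) (.resolved (a₀, l)))) :
    LoadDep (after buf s) (Function.update μ a₀ (some v₀)) i a v dep := by
  have hdom {k} (hk : after buf s k ≠ none) : s < k ∧ buf k ≠ none := by
    simpa [after] using hk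
  cases h with
  | @forwarded j _ hj hbj hsa hs' =>
    obtain hjs | rfl | hsj := lt_trichotomy j s
    · exact absurd hbj (hs j hjs _ _)
    · simp only [hb, Option.some.injEq, Trans.store.injEq, Operand.val.injEq] at hbj
      obtain ⟨rfl, rfl⟩ := hbj
      obtain rfl := hsa _ _ rfl
      refine .memory (Function.update_self ..) (fun k t _ hki hk => ?_) fun k hk => ?_
      · obtain ⟨hjk, hbk⟩ := after_eq_some_iff.mp hk
        exact hs' k t hjk hki hbk
      · exact_mod_cast (hdom hk).1
    · exact .forwarded hj ((after_of_lt hsj).trans hbj) hsa hs'.drop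
  | memory hm hs' hdep =>
    have hne : a ≠ a₀ := by
      rintro rfl
      exact hs' s _ s.zero_le hsi hb ⟨_, _, rfl⟩
    exact .memory ((Function.update_of_ne hne ..).trans hm) hs'.drop fun k hk =>
      hdep k (hdom hk).2

theorem LoadDep.mem_eq (h : LoadDep buf μ i a v dep)
    (hs : ∀ j < i, ∀ src sa, buf j ≠ some (.store src sa)) : μ a = some v := by
  cases h with
  | forwarded hj hbj => exact absurd hbj (hs _ hj _ _)
  | memory hm => exact hm

end LoadDep

section LoadDepInsert

variable {V L R F B : Type*} {buf : Buf V L R F B} {μ : V → Option (V × L)} {i k : ℕ} {a : V}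
  {v : V × L} {dep : WithBot ℕ} {u u' : Trans V L R F B}

theorem NoStore.replace {lo : ℕ} (h : NoStore buf a lo k) (hi : lo ≤ i → i < k → ¬ u'.StoresTo a) :
    NoStore (insert buf i u') a lo k := fun j t hlo hjk hj => by
  obtain rfl | hji := eq_or_ne j i
  · obtain rfl := Option.some.inj (insert_self.symm.trans hj)
    exact hi hlo hjk
  · exact h j t hlo hjk ((insert_of_ne hji).symm.trans hj)

theorem insert_ne_none_iff (hu : buf i = some u) : insert buf i u' k ≠ none ↔ buf k ≠ none := by
  obtain rfl | hki := eq_or_ne k i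
  · simp [hu]
  · rw [insert_of_ne hki]

theorem LoadDep.replace (h : LoadDep buf μ k a v dep) (hu : buf i = some u)
    (hstore : ∀ w sa, u = .store (.val w) sa → u' = u)
    (haddr : ∀ b, u'.StoresTo b → u.StoresTo b) : LoadDep (insert buf i u') μ k a v dep := by
  cases h with
  | @forwarded j _ hj hb hsa hs =>
    refine .forwarded hj ?_ hsa (hs.replace fun hlo hik ha => hs i u hlo hik hu (haddr a ha))
    obtain rfl | hji := eq_or_ne j i
    · rw [insert_self, ← hb, hu, hstore _ _ (Option.some.inj (hu.symm.trans hb))]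
    · rw [insert_of_ne hji, hb]
  | memory hm hs hdep =>
    exact .memory hm (hs.replace fun hlo hik ha => hs i u hlo hik hu (haddr a ha)) fun j hj =>
      hdep j ((insert_ne_none_iff hu).mp hj)

theorem LoadDep.replace_resolved {src : Operand V L R} {args : List (Operand V L R)} {b : V} {l : L}
    {r : R} {pc : V} (h : LoadDep buf μ k a v dep) (hu : buf i = some (.store src (.pending args)))
    (hk : i < k → ¬ (Trans.loadVal r v dep a pc : Trans V L R F B).Hazard i b pc) :
    LoadDep (insert buf i (.store src (.resolved (b, l)))) μ k a v dep := by
  have hN {lo : ℕ} (hlo : lo ≤ i → dep < (i : WithBot ℕ)) (hs : NoStore buf a lo k) :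
      NoStore (insert buf i (.store src (.resolved (b, l)))) a lo k :=
    hs.replace fun hli hik => by
      rintro ⟨_, _, h⟩
      cases h
      exact hk hik (.stale r v dep (hlo hli))
  cases h with
  | @forwarded j sa hj hb hsa hs =>
    have hs' := hN (fun hji => by exact_mod_cast hji) hs
    obtain rfl | hji := eq_or_ne j i
    · simp only [hu, Option.some.injEq, Trans.store.injEq] at hb
      refine .forwarded hj (by rw [insert_self, hb.1]) ?_ hs'
      rintro a' l ⟨⟩
      by_contra hne
      exact hk hj (.misforward r v a (Ne.symm hne))
    · exact .forwarded hj ((insert_of_ne hji).trans hb) hsa hs'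
  | memory hm hs hdep =>
    exact .memory hm (hN (fun _ => hdep i (by simp [hu])) hs) fun j hj =>
      hdep j ((insert_ne_none_iff hu).mp hj)

end LoadDepInsert

section Fetches

variable {V L R F B : Type*} [Lattice L] [OrderBot L]

/-- `Fetches M P p l n`: fetching the instruction at `p` adds the entries `l` to the buffer, and `n`
is a possible next program point. In the case `abandonedRet` the load of a return has been rolled
back; this leaves the single entry `ret` behind, and the return is fetched again. -/
inductive Fetches (M : Machine V R F B) (P : Program V L R F B) :
    V → List (Trans V L R F B) → V → Prop
  | op {p f r args n} (hI : P p = some (.op f r args n)) : Fetches M P p [.op f r args] n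
  | load {p r args n} (hI : P p = some (.load r args n)) : Fetches M P p [.load r args p] n
  | store {p src args n} (hI : P p = some (.store src args n)) :
      Fetches M P p [.store src (.pending args)] n
  | fence {p n} (hI : P p = some (.fence n)) : Fetches M P p [.fence] n
  | br {p f args nt nf} (hI : P p = some (.br f args nt nf)) (n) :
      Fetches M P p [.br f args n nt nf] n
  | jmpi {p args} (hI : P p = some (.jmpi args)) (n) : Fetches M P p [.jmpi args n] n
  | call {p nf nr} (hI : P p = some (.call nf nr)) :
      Fetches M P p [.call, .op M.succ M.rsp [.reg M.rsp],
        .store (.val (nr, ⊥)) (.pending [.reg M.rsp])] nf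
  | ret {p} (hI : P p = some .ret) (n) :
      Fetches M P p [.ret, .load M.rret [.reg M.rsp] p, .op M.pred M.rsp [.reg M.rsp],
        .jmpi [.reg M.rret] n] n
  | abandonedRet {p} (hI : P p = some .ret) : Fetches M P p [.ret] p

/-- `Path M P p h n`: the entries `h` are fetched in this order, starting at `p`, and `n` is the
program point that is reached. -/
inductive Path (M : Machine V R F B) (P : Program V L R F B) :
    V → List (Trans V L R F B) → V → Prop
  | nil (p) : Path M P p [] p
  | cons {p q n l h} : Fetches M P p l q → Path M P q h n → Path M P p (l ++ h) n

variable {M : Machine V R F B} {P : Program V L R F B} {p q n : V} {l h : List (Trans V L R F B)}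
  {t : Trans V L R F B} {k : ℕ}

theorem Fetches.of_simple {I : Instr V L R F B} (hI : P p = some I)
    (ht : I.simple p = some (t, n)) : Fetches M P p [t] n := by
  cases I <;> cases ht
  exacts [.op hI, .load hI, .store hI, .fence hI]

theorem Fetches.ne_nil (hl : Fetches M P p l n) : l ≠ [] := by
  cases hl <;> exact List.cons_ne_nil _ _

theorem Path.of_fetches (hl : Fetches M P p l n) : Path M P p l n :=
  l.append_nil ▸ .cons hl (.nil n)

theorem Path.append_fetches (hp : Path M P p h q) (hl : Fetches M P q l n) :
    Path M P p (h ++ l) n := by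
  induction hp with
  | nil => exact .of_fetches hl
  | cons hf _ ih => exact List.append_assoc .. ▸ .cons hf (ih hl)

theorem Path.exists_fetches_of_cons (hp : Path M P p (t :: h) n) :
    ∃ l q h', h = l ++ h' ∧ Fetches M P p (t :: l) q ∧ Path M P q h' n := by
  generalize hth : t :: h = th at hp
  cases hp with
  | nil => cases hth
  | @cons _ q _ l' h' hl hp' =>
    cases l' with
    | nil => exact absurd rfl hl.ne_nil
    | cons t' l' =>
      obtain ⟨rfl, rfl⟩ := List.cons.inj hth
      exact ⟨l', q, h', rfl, hl, hp'⟩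

theorem Path.take_append {s : List (Trans V L R F B)} {n' : V}
    (hs : ∀ p l q j, Fetches M P p l q → l[j]? = some t → Path M P p (l.take j ++ s) n')
    (hp : Path M P p h n) (hk : h[k]? = some t) : Path M P p (h.take k ++ s) n' := by
  induction hp generalizing k with
  | nil => simp at hk
  | @cons _ _ _ l h hl _ ih =>
    obtain hkl | hlk := lt_or_ge k l.length
    · rw [List.take_append_of_le_length hkl.le]
      exact hs _ _ _ _ hl (List.getElem?_append_left hkl ▸ hk)
    · rw [List.take_append, List.take_of_length_le hlk, List.append_assoc]
      exact .cons hl (ih (List.getElem?_append_right hlk ▸ hk))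

theorem Path.take_load {r : R} {args : List (Operand V L R)} {pc : V} (hp : Path M P p h n)
    (hk : h[k]? = some (.load r args pc)) : Path M P p (h.take k) pc := by
  rw [← (h.take k).append_nil]
  refine Path.take_append (fun p l q j hl hj => ?_) hp hk
  cases hl <;> rcases j with _ | _ | _ | _ | j <;> simp only [List.getElem?_cons_zero,
    List.getElem?_cons_succ, List.getElem?_nil, Option.some.injEq, Trans.load.injEq,
    reduceCtorEq] at hj
  case load.zero => exact hj.2.2 ▸ .nil _
  case ret.succ.zero hI => exact hj.2.2 ▸ .of_fetches (.abandonedRet hI)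

theorem Path.take_br {f : B} {args : List (Operand V L R)} {g nt nf : V} (hp : Path M P p h n)
    (hk : h[k]? = some (.br f args g nt nf)) (g' : V) :
    Path M P p (h.take k ++ [.br f args g' nt nf]) g' := by
  refine Path.take_append (fun p l q j hl hj => ?_) hp hk
  cases hl <;> rcases j with _ | _ | _ | _ | j <;> simp only [List.getElem?_cons_zero,
    List.getElem?_cons_succ, List.getElem?_nil, Option.some.injEq, Trans.br.injEq,
    reduceCtorEq] at hj
  case br.zero hI =>
    obtain ⟨rfl, rfl, -, rfl, rfl⟩ := hj
    exact .of_fetches (.br hI g')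

theorem Path.take_jmpi {args : List (Operand V L R)} {g : V} (hp : Path M P p h n)
    (hk : h[k]? = some (.jmpi args g)) (g' : V) :
    Path M P p (h.take k ++ [.jmpi args g']) g' := by
  refine Path.take_append (fun p l q j hl hj => ?_) hp hk
  cases hl <;> rcases j with _ | _ | _ | _ | j <;> simp only [List.getElem?_cons_zero,
    List.getElem?_cons_succ, List.getElem?_nil, Option.some.injEq, Trans.jmpi.injEq,
    reduceCtorEq] at hj
  case jmpi.zero hI => exact hj.1 ▸ .of_fetches (.jmpi hI g')
  case ret.succ.succ.succ.zero hI => exact hj.1 ▸ .of_fetches (.ret hI g')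

theorem Path.head?_eq_ret (hp : Path M P p h n) (hI : P p = some .ret) (ht : h.head? = some t) :
    t = .ret := by
  cases hp with
  | nil => simp at ht
  | cons hl => cases hl <;> simp_all

/-- The operands that a transient instruction has yet to read. -/
def Trans.reads {V L R F B : Type*} : Trans V L R F B → List (Operand V L R)
  | .op _ _ args => args
  | .br _ args _ _ _ => args
  | .load _ args _ => args
  | .store src (.pending args) => src :: args
  | .jmpi args _ => args
  | _ => []

/-- No instruction of the program reads the temporary register for return addresses. -/
def RretFree (M : Machine V R F B) (P : Program V L R F B) : Prop :=
  ∀ n I, P n = some I → Operand.reg M.rret ∉ I.operands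

theorem Fetches.exists_dest_eq_rret (hP : RretFree M P) (hl : Fetches M P p l n)
    (hk : l[k]? = some t) (ht : .reg M.rret ∈ t.reads) :
    ∃ j < k, ∃ t', l[j]? = some t' ∧ t'.dest = some M.rret := by
  have hne := M.rsp_ne_rret.symm
  cases hl <;> rcases k with _ | _ | _ | _ | k <;> simp only [List.getElem?_cons_zero,
    List.getElem?_cons_succ, List.getElem?_nil, Option.some.injEq, reduceCtorEq] at hk <;> subst hk
  case ret.succ.succ.succ.zero => exact ⟨1, by omega, _, rfl, rfl⟩
  all_goals rename_i hI
  all_goals first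
    | exact absurd ht (hP _ _ hI)
    | simp [Trans.reads, hne] at ht

theorem Path.exists_dest_eq_rret (hP : RretFree M P) (hp : Path M P p h n)
    (hk : h[k]? = some t) (ht : .reg M.rret ∈ t.reads) :
    ∃ j < k, ∃ t', h[j]? = some t' ∧ t'.dest = some M.rret := by
  induction hp generalizing k with
  | nil => simp at hk
  | @cons _ _ _ l h hl _ ih =>
    obtain hkl | hlk := lt_or_ge k l.length
    · rw [List.getElem?_append_left hkl] at hk
      obtain ⟨j, hjk, t', hj, hd⟩ := hl.exists_dest_eq_rret hP hk ht
      exact ⟨j, hjk, t', by rwa [List.getElem?_append_left (hjk.trans hkl)], hd⟩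
    · rw [List.getElem?_append_right hlk] at hk
      obtain ⟨j, hjk, t', hj, hd⟩ := ih hk
      refine ⟨l.length + j, by omega, t', ?_, hd⟩
      rwa [List.getElem?_append_right (Nat.le_add_right ..), Nat.add_sub_cancel_left]

end Fetches

section Tracks

/-- Entries other than stores as they are when they have just been fetched. -/
def Trans.Unresolved {V L R F B : Type*} : Trans V L R F B → Prop
  | .op _ _ _ => True
  | .br _ _ _ _ _ => True
  | .load _ _ _ => True
  | .jmpi _ _ => True
  | .call => True
  | .ret => True
  | .fence => True
  | _ => False

variable {V L R F B : Type*} [DecidableEq R] [Lattice L] [OrderBot L]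

/-- `Tracks M buf ρ μ i t u`: the entry `u` at index `i` results from executing the fetched
instruction `t` on the operand values that are visible at `i`. -/
inductive Tracks (M : Machine V R F B) (buf : Buf V L R F B) (ρ : R → Option (V × L))
    (μ : V → Option (V × L)) (i : ℕ) : Trans V L R F B → Trans V L R F B → Prop
  | refl {t} (h : t.Unresolved) : Tracks M buf ρ μ i t t
  | op {f r args vs} (hv : resolveAll buf ρ i args = some vs) :
      Tracks M buf ρ μ i (.op f r args) (.val r (M.evalOp f (vals vs), lub vs))
  | br {f args n nt nf vs} (hv : resolveAll buf ρ i args = some vs)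
      (hn : cond (M.evalCond f (vals vs)) nt nf = n) :
      Tracks M buf ρ μ i (.br f args n nt nf) (.jump n)
  | jmpi {args n vs} (hv : resolveAll buf ρ i args = some vs) (hn : M.addr (vals vs) = n) :
      Tracks M buf ρ μ i (.jmpi args n) (.jump n)
  | loadFwd {r args v j pc} (hj : j < i) :
      Tracks M buf ρ μ i (.load r args pc) (.loadFwd r args v j pc)
  | loadVal {r args v dep a pc vs} (hv : resolveAll buf ρ i args = some vs)
      (ha : M.addr (vals vs) = a) (hd : LoadDep buf μ i a v dep) :
      Tracks M buf ρ μ i (.load r args pc) (.loadVal r v dep a pc)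
  | store {src args src' sa}
      (hs : src' = src ∨ ∃ v, src' = .val v ∧ resolve buf ρ i src = some v)
      (hv : sa = .pending args ∨
        ∃ vs, resolveAll buf ρ i args = some vs ∧ sa = .resolved (M.addr (vals vs), lub vs)) :
      Tracks M buf ρ μ i (.store src (.pending args)) (.store src' sa)

variable {M : Machine V R F B} {P : Program V L R F B} {buf buf' : Buf V L R F B}
  {ρ ρ' : R → Option (V × L)} {μ μ' : V → Option (V × L)} {i : ℕ} {t u : Trans V L R F B}

theorem Tracks.dest_eq (h : Tracks M buf ρ μ i t u) : u.dest = t.dest := by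
  cases h <;> rfl

theorem Tracks.mono (h : Tracks M buf ρ μ i t u)
    (hr : ∀ r, .reg r ∈ t.reads → ∀ v, resolveReg buf ρ i r = some v →
      resolveReg buf' ρ' i r = some v)
    (hd : ∀ r v dep a pc, u = .loadVal r v dep a pc → LoadDep buf μ i a v dep →
      LoadDep buf' μ' i a v dep) : Tracks M buf' ρ' μ' i t u := by
  have hargs {args vs} (hsub : args ⊆ t.reads) (hv : resolveAll buf ρ i args = some vs) :
      resolveAll buf' ρ' i args = some vs := by
    rw [resolveAll_eq_evalAll] at hv ⊢
    exact evalAll_mono (fun r hra => hr r (hsub hra)) hv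
  cases h with
  | refl h => exact .refl h
  | op hv => exact .op (hargs (List.Subset.refl _) hv)
  | br hv hn => exact .br (hargs (List.Subset.refl _) hv) hn
  | jmpi hv hn => exact .jmpi (hargs (List.Subset.refl _) hv) hn
  | loadFwd hj => exact .loadFwd hj
  | loadVal hv ha h => exact .loadVal (hargs (List.Subset.refl _) hv) ha (hd _ _ _ _ _ rfl h)
  | store hs hv =>
    refine .store (hs.imp_right ?_) (hv.imp_right ?_)
    · rintro ⟨v, rfl, hv⟩
      rw [resolve_eq_eval] at hv
      refine ⟨v, rfl, ?_⟩
      rw [resolve_eq_eval]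
      exact Operand.eval_mono (fun r hor => hr r (hor ▸ List.mem_cons_self)) hv
    · rintro ⟨vs, hvs, rfl⟩
      exact ⟨vs, hargs (List.subset_cons_self _ _) hvs, rfl⟩

theorem Tracks.congr (h : Tracks M buf ρ μ i t u) (hi : buf i ≠ none)
    (hb : ∀ j < i, buf' j = buf j) : Tracks M buf' ρ μ i t u :=
  h.mono (fun r _ v hv => by rwa [resolveReg_congr hb]) fun _ _ _ _ _ _ hd => hd.congr hi hb

theorem Fetches.tracks {p n : V} {l : List (Trans V L R F B)} (hl : Fetches M P p l n)
    (ht : t ∈ l) : Tracks M buf ρ μ i t t := by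
  have hcases : t.Unresolved ∨ ∃ src args, t = .store src (.pending args) := by
    cases hl <;> simp only [List.mem_cons, List.not_mem_nil, or_false] at ht <;>
      rcases ht with rfl | rfl | rfl | rfl <;> simp [Trans.Unresolved]
  obtain h | ⟨src, args, rfl⟩ := hcases
  exacts [.refl h, .store (.inl rfl) (.inl rfl)]

end Tracks

section InFlight

variable {V L R F B : Type*} [DecidableEq R] [Lattice L] [OrderBot L]

/-- The buffer of `C` consists of the results of executing, in part and in any order, the entries
`h`, which were fetched from the program point `p` on and put at the indices from `i₀` on. -/
structure InFlight (M : Machine V R F B) (P : Program V L R F B) (p : V) (C : Config V L R F B)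
    (i₀ : ℕ) (h : List (Trans V L R F B)) : Prop where
  path : Path M P p h C.pc
  eq_none_of_lt : ∀ i < i₀, C.buf i = none
  eq_none_of_le : ∀ i, i₀ + h.length ≤ i → C.buf i = none
  exists_tracks : ∀ k t, h[k]? = some t →
    ∃ u, C.buf (i₀ + k) = some u ∧ Tracks M C.buf C.reg C.mem (i₀ + k) t u

namespace InFlight

variable {M : Machine V R F B} {P : Program V L R F B} {p n : V} {C : Config V L R F B}
  {i₀ i k : ℕ} {h l : List (Trans V L R F B)} {u u' : Trans V L R F B}

theorem of_terminal (hC : C.Terminal) (i₀ : ℕ) : InFlight M P C.pc C i₀ [] where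
  path := .nil _
  eq_none_of_lt i _ := hC i
  eq_none_of_le i _ := hC i
  exists_tracks k t hk := by simp at hk

theorem exists_entry (hI : InFlight M P p C i₀ h) (hb : C.buf i = some u) :
    ∃ k t, i = i₀ + k ∧ h[k]? = some t ∧ Tracks M C.buf C.reg C.mem i t u := by
  have hle : i₀ ≤ i := not_lt.mp fun hlt => by simp [hI.eq_none_of_lt i hlt] at hb
  obtain ⟨k, rfl⟩ := Nat.exists_eq_add_of_le hle
  have hk : k < h.length := not_le.mp fun hle => by
    simp [hI.eq_none_of_le (i₀ + k) (Nat.add_le_add_left hle i₀)] at hb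
  obtain ⟨u', hb', ht⟩ := hI.exists_tracks k h[k] (List.getElem?_eq_getElem hk)
  obtain rfl := Option.some.inj (hb.symm.trans hb')
  exact ⟨k, h[k], rfl, List.getElem?_eq_getElem hk, ht⟩

theorem eq_nil_of_terminal (hI : InFlight M P p C i₀ h) (hC : C.Terminal) : h = [] := by
  rcases h with _ | ⟨t, h⟩
  · rfl
  · obtain ⟨u, hu, -⟩ := hI.exists_tracks 0 t rfl
    simp [hC _] at hu

theorem pc_eq_of_terminal (hI : InFlight M P p C i₀ h) (hC : C.Terminal) : C.pc = p := by
  obtain rfl := hI.eq_nil_of_terminal hC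
  generalize hn : C.pc = n
  have hp := hn ▸ hI.path
  generalize hl : ([] : List (Trans V L R F B)) = l at hp
  cases hp with
  | nil => rfl
  | cons hf => exact absurd (List.append_eq_nil_iff.mp hl.symm).1 hf.ne_nil

theorem exists_fresh_eq (hI : InFlight M P p C i₀ h) :
    ∃ i₁, InFlight M P p C i₁ h ∧ fresh C.buf = i₁ + h.length := by
  rcases h with _ | ⟨t, h⟩
  · have hnone (i : ℕ) : C.buf i = none :=
      (lt_or_ge i i₀).elim (hI.eq_none_of_lt i) (hI.eq_none_of_le i)
    exact ⟨1, ⟨hI.path, fun i _ => hnone i, fun i _ => hnone i, by simp⟩,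
      fresh_of_forall_eq_none hnone⟩
  · refine ⟨i₀, hI, fresh_eq_of_forall_lt (fun k hk => hI.eq_none_of_le k hk) ?_⟩
    obtain ⟨u, hu, -⟩ := hI.exists_tracks h.length _ (List.getElem?_eq_getElem (by simp))
    simp [hu]

theorem take_append {s : List (Trans V L R F B)} {buf' : Buf V L R F B}
    (hI : InFlight M P p C i₀ h) (hk : k ≤ h.length) (hp : Path M P p (h.take k ++ s) n)
    (hlt : ∀ j < i₀ + k, buf' j = C.buf j) (hle : ∀ j, i₀ + k + s.length ≤ j → buf' j = none)
    (hs : ∀ j t, s[j]? = some t → ∃ u, buf' (i₀ + k + j) = some u ∧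
      Tracks M buf' C.reg C.mem (i₀ + k + j) t u) :
    InFlight M P p { C with pc := n, buf := buf' } i₀ (h.take k ++ s) := by
  have hlen : (h.take k).length = k := List.length_take_of_le hk
  refine ⟨hp, fun i hi => (hlt i (Nat.lt_add_right k hi)).trans (hI.eq_none_of_lt i hi),
    fun i hi => hle i (by simpa [hlen, ← Nat.add_assoc] using hi), fun j t hj => ?_⟩
  obtain hjk | hkj := lt_or_ge j k
  · rw [List.getElem?_append_left (hlen.symm ▸ hjk), List.getElem?_take_of_lt hjk] at hj
    obtain ⟨u, hu, ht⟩ := hI.exists_tracks j t hj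
    exact ⟨u, (hlt _ (by omega)).trans hu,
      ht.congr (by simp [hu]) fun i hi => hlt i (by omega)⟩
  · obtain ⟨j, rfl⟩ := Nat.exists_eq_add_of_le hkj
    rw [List.getElem?_append_right (hlen.symm ▸ hkj), hlen, Nat.add_sub_cancel_left] at hj
    exact Nat.add_assoc i₀ k j ▸ hs j t hj

theorem truncate (hI : InFlight M P p C i₀ h) (hk : k ≤ h.length) (hp : Path M P p (h.take k) n) :
    InFlight M P p { C with pc := n, buf := before C.buf (i₀ + k) } i₀ (h.take k) := by
  simpa using hI.take_append (s := []) hk (by simpa using hp) (fun _ => before_of_lt)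
    (fun _ => before_of_le) (by simp)

theorem redirect {t : Trans V L R F B} (hI : InFlight M P p C i₀ h) (hk : k ≤ h.length)
    (hp : Path M P p (h.take k ++ [t]) n) (hb : C.buf (i₀ + k) ≠ none)
    (ht : Tracks M C.buf C.reg C.mem (i₀ + k) t u) :
    InFlight M P p { C with pc := n, buf := insert (before C.buf (i₀ + k)) (i₀ + k) u } i₀
      (h.take k ++ [t]) := by
  have hlt : ∀ j < i₀ + k, insert (before C.buf (i₀ + k)) (i₀ + k) u j = C.buf j := fun j hj =>
    (insert_of_ne hj.ne).trans (before_of_lt hj)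
  refine hI.take_append hk hp hlt (fun j (hj : i₀ + k < j) => ?_) fun j t' hj => ?_
  · exact (insert_of_ne hj.ne').trans (before_of_le hj.le)
  · obtain ⟨rfl, rfl⟩ : j = 0 ∧ t = t' := by simpa [List.getElem?_singleton] using hj
    exact ⟨u, insert_self, ht.congr hb hlt⟩

theorem replace (hI : InFlight M P p C i₀ h) (hb : C.buf i = some u)
    (ht : ∀ t, Tracks M C.buf C.reg C.mem i t u → Tracks M C.buf C.reg C.mem i t u')
    (hval : ∀ v, u.value = some v → u'.value = some v)
    (hload : ∀ k r v dep a pc, C.buf k = some (.loadVal r v dep a pc) →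
      LoadDep C.buf C.mem k a v dep → LoadDep (insert C.buf i u') C.mem k a v dep) :
    InFlight M P p { C with buf := insert C.buf i u' } i₀ h := by
  have hnone {j : ℕ} (hj : C.buf j = none) : insert C.buf i u' j = none := by
    rwa [insert_of_ne (by rintro rfl; simp [hb] at hj)]
  refine ⟨hI.path, fun j hj => hnone (hI.eq_none_of_lt j hj),
    fun j hj => hnone (hI.eq_none_of_le j hj), fun k t hk => ?_⟩
  obtain ⟨w, hw, htw⟩ := hI.exists_tracks k t hk
  obtain hki | hki := eq_or_ne (i₀ + k) i
  · obtain rfl : u = w := Option.some.inj (hb.symm.trans (hki ▸ hw))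
    exact ⟨u', hki ▸ insert_self, hki ▸ (ht t (hki ▸ htw)).congr (by simp [hb]) fun j hj =>
      insert_of_ne hj.ne⟩
  · obtain ⟨_, t₀, -, -, ht₀⟩ := hI.exists_entry hb
    exact ⟨w, (insert_of_ne hki).trans hw, htw.mono
      (fun r _ v => resolveReg_insert hb ((ht t₀ ht₀).dest_eq.trans ht₀.dest_eq.symm) hval)
      fun r v dep a pc hu => hload _ r v dep a pc (hu ▸ hw)⟩

theorem replace_of_not_store (hI : InFlight M P p C i₀ h) (hb : C.buf i = some u)
    (ht : ∀ t, Tracks M C.buf C.reg C.mem i t u → Tracks M C.buf C.reg C.mem i t u')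
    (hval : ∀ v, u.value = some v → u'.value = some v)
    (hu : ∀ src sa, u ≠ .store src sa) (hu' : ∀ src sa, u' ≠ .store src sa) :
    InFlight M P p { C with buf := insert C.buf i u' } i₀ h :=
  hI.replace hb ht hval fun _ _ _ _ _ _ _ hd => hd.replace hb (fun _ sa hw => absurd hw (hu _ sa))
    fun _ ⟨src, _, ha⟩ => absurd ha (hu' src _)

end InFlight

end InFlight

section Retire

theorem Trans.IsVal.ne_store {V L R F B : Type*} {u : Trans V L R F B} {r : R} {v : V × L}
    (hu : u.IsVal r v) (src : Operand V L R) (sa : StoreAddr V L R) : u ≠ .store src sa := by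
  cases hu <;> simp

variable {V L R F B : Type*} [DecidableEq R] [Lattice L] [OrderBot L]
  {M : Machine V R F B} {P : Program V L R F B} {p q : V} {C : Config V L R F B}
  {i i₀ k m : ℕ} {h h' l : List (Trans V L R F B)} {t u : Trans V L R F B}

theorem InFlight.tracks (hI : InFlight M P p C i₀ h) (hk : h[k]? = some t)
    (hb : C.buf (i₀ + k) = some u) : Tracks M C.buf C.reg C.mem (i₀ + k) t u := by
  obtain ⟨u', hb', ht⟩ := hI.exists_tracks k t hk
  exact Option.some.inj (hb'.symm.trans hb) ▸ ht

theorem InFlight.resolveReg_eq (hI : InFlight M P p C i h) :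
    resolveReg C.buf C.reg i = C.reg :=
  resolveReg_of_none hI.eq_none_of_lt

theorem InFlight.exists_head (hI : InFlight M P p C i₀ h) (hi : minIdx C.buf = i)
    (hb : C.buf i = some u) : ∃ t l q h', InFlight M P p C i (t :: l ++ h') ∧
      Fetches M P p (t :: l) q ∧ Path M P q h' C.pc ∧ Tracks M C.buf C.reg C.mem i t u := by
  obtain ⟨k, t, rfl, hk, -⟩ := hI.exists_entry hb
  obtain ⟨t, h, rfl⟩ := List.exists_cons_of_ne_nil (l := h) (by rintro rfl; simp at hk)
  obtain ⟨u', hu', -⟩ := hI.exists_tracks 0 t rfl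
  obtain rfl : k = 0 := by
    have := minIdx_eq_of_forall_lt hI.eq_none_of_lt (by simpa using hu' ▸ Option.some_ne_none _)
    omega
  obtain ⟨l, q, h', rfl, hl, hp⟩ := hI.path.exists_fetches_of_cons
  exact ⟨t, l, q, h', hI, hl, hp, hI.tracks rfl hb⟩

-- `M.rret` is exempt in `hρ` because a return resets it to its old value on retirement; a later
-- entry that reads it is always preceded by one that assigns it.
theorem InFlight.drop (hP : RretFree M P)
    (hI : InFlight M P p C i₀ (l ++ h')) (hp : Path M P q h' C.pc) (hm : i₀ + l.length = m + 1)
    {ρ' : R → Option (V × L)} {μ' : V → Option (V × L)}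
    (hρ : ∀ r, r ≠ M.rret → ρ' r = resolveReg C.buf C.reg (m + 1) r)
    (hμ : ∀ k a v dep, m < k → LoadDep C.buf C.mem k a v dep →
      LoadDep (after C.buf m) μ' k a v dep) :
    InFlight M P q ⟨ρ', μ', C.pc, after C.buf m⟩ (m + 1) h' := by
  have hb {j : ℕ} (hj : m + 1 ≤ j) : after C.buf m j = C.buf j := after_of_lt hj
  have htracks (k t) (hk : h'[k]? = some t) :
      ∃ u, C.buf (m + 1 + k) = some u ∧ Tracks M C.buf C.reg C.mem (m + 1 + k) t u := by
    rw [← hm, Nat.add_assoc]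
    refine hI.exists_tracks _ t ?_
    rw [List.getElem?_append_right (Nat.le_add_right ..), Nat.add_sub_cancel_left, hk]
  refine ⟨hp, fun j hj => after_of_le (Nat.lt_succ_iff.mp hj), fun j hj => ?_, fun k t hk => ?_⟩
  · refine (hb (le_of_add_le_left hj)).trans (hI.eq_none_of_le j ?_)
    rw [List.length_append]
    omega
  · obtain ⟨u, hu, ht⟩ := htracks k t hk
    refine ⟨u, (hb (Nat.le_add_right ..)).trans hu, ht.mono (fun r hr v hv => ?_)
      fun r v dep a pc _ => hμ _ a v dep (by omega)⟩
    rw [resolveReg_after (by omega), hv]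
    by_cases hrret : r = M.rret
    · obtain ⟨j, hj, t', hjt, hd⟩ := hp.exists_dest_eq_rret hP hk (hrret ▸ hr)
      obtain ⟨u', hu', ht'⟩ := htracks j t' hjt
      exact .inr ⟨_, u', by omega, by omega, hu', by rw [ht'.dest_eq, hd, hrret]⟩
    · exact .inl (hρ r hrret)

variable {buf : Buf V L R F B} {ρ : R → Option (V × L)} {μ : V → Option (V × L)} {r : R}
  {v : V × L} {a n : V} {lb : L}

theorem Tracks.exists_of_op {f : F} {r r' : R} (ht : Tracks M buf ρ μ i (.op f r [.reg r']) u)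
    (hu : u.IsVal r v) : ∃ w, resolveReg buf ρ i r' = some w ∧
      v = (M.evalOp f (vals [w]), lub [w]) := by
  cases hu <;> cases ht
  case val.op hv =>
  rw [resolveAll_eq_evalAll, evalAll_singleton_reg] at hv
  obtain ⟨w, hw, rfl⟩ := hv
  exact ⟨w, hw, rfl⟩

theorem Tracks.exists_of_load {r r' : R} {pc : V}
    (ht : Tracks M buf ρ μ i (.load r [.reg r'] pc) u) (hu : u.IsVal r v) :
    ∃ w dep, resolveReg buf ρ i r' = some w ∧ LoadDep buf μ i (M.addr (vals [w])) v dep := by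
  cases hu <;> cases ht
  case loadVal.loadVal hv ha hd =>
  rw [resolveAll_eq_evalAll, evalAll_singleton_reg] at hv
  obtain ⟨w, hw, rfl⟩ := hv
  exact ⟨w, _, hw, ha ▸ hd⟩

theorem Tracks.exists_of_store (ht : Tracks M buf ρ μ i t (.store (.val v) (.resolved (a, lb)))) :
    ∃ src args vs, t = .store src (.pending args) ∧ resolve buf ρ i src = some v ∧
      resolveAll buf ρ i args = some vs ∧ M.addr (vals vs) = a := by
  cases ht with
  | refl h => exact h.elim
  | @store src args _ _ hs ha =>
    obtain ⟨vs, hvs, ha⟩ := ha.resolve_left (by simp)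
    refine ⟨src, args, vs, rfl, ?_, hvs, by cases ha; rfl⟩
    rcases hs with rfl | ⟨w, hw, hv⟩
    · rfl
    · cases hw
      exact hv

theorem InFlight.eq_ret_block (hI : InFlight M P p C i (.ret :: l ++ h'))
    (hl : Fetches M P p (.ret :: l) q) (hp : Path M P q h' C.pc) (hb : C.buf (i + 1) = some u)
    (hu : u.IsVal r v) :
    P p = some .ret ∧ l =
      [.load M.rret [.reg M.rsp] p, .op M.pred M.rsp [.reg M.rsp], .jmpi [.reg M.rret] q] := by
  cases hl with
  | ret hI' => exact ⟨hI', rfl⟩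
  | abandonedRet hI' =>
    obtain ⟨k, t, hk, hkt, ht⟩ := hI.exists_entry hb
    obtain rfl : k = 1 := by omega
    obtain rfl := hp.head?_eq_ret hI' (List.head?_eq_getElem? ▸ hkt)
    cases hu <;> cases ht

/-- The buffer of `C` holds a predicted path that starts at `p`: the program point `p` is that of
the oldest entry, or the current one if there is no entry. -/
def Ahead (M : Machine V R F B) (P : Program V L R F B) (p : V) (C : Config V L R F B) : Prop :=
  ∃ i₀ h, InFlight M P p C i₀ h

theorem InFlight.drop_control (hP : RretFree M P)
    (hI : InFlight M P p C i ([t] ++ h')) (hp : Path M P q h' C.pc) (hb : C.buf i = some u)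
    (hd : u.dest = none) (hs : ∀ src sa, u ≠ .store src sa) :
    Ahead M P q ⟨C.reg, C.mem, C.pc, after C.buf i⟩ := by
  refine ⟨_, _, InFlight.drop hP hI hp rfl (fun r _ => ?_)
    fun _ _ _ _ _ hL => hL.drop fun j hj src sa hst => ?_⟩
  · rw [resolveReg_succ_of_dest_eq_none hb hd, hI.resolveReg_eq]
  · obtain hj | rfl := hj.lt_or_eq
    · simp [hI.eq_none_of_lt j hj] at hst
    · exact hs src sa (Option.some.inj (hb.symm.trans hst))

variable [DecidableEq V]

theorem Ahead.retire_value (hP : RretFree M P)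
    (hA : Ahead M P p C) (hi : minIdx C.buf = i) (hb : C.buf i = some u) (hu : u.IsVal r v) :
    ∃ q, ArchStep M P ⟨C.reg, C.mem, p⟩ ⟨Function.update C.reg r (some v), C.mem, q⟩ ∧
      Ahead M P q ⟨Function.update C.reg r (some v), C.mem, C.pc, after C.buf i⟩ := by
  obtain ⟨_, _, hI⟩ := hA
  obtain ⟨t, l, q, h', hI, hl, hp, ht⟩ := hI.exists_head hi hb
  have hnostore : ∀ j < i, ∀ src sa, C.buf j ≠ some (.store src sa) := fun j hj => by
    simp [hI.eq_none_of_lt j hj]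
  have hdrop (hnil : l = []) :
      Ahead M P q ⟨Function.update C.reg r (some v), C.mem, C.pc, after C.buf i⟩ := by
    refine ⟨_, _, InFlight.drop hP hI hp (by simp [hnil]) (fun r' _ => ?_)
      fun _ _ _ _ _ hd => hd.drop fun j hj src sa hs => ?_⟩
    · rw [resolveReg_succ_of_isVal hb hu, hI.resolveReg_eq]
    · obtain hj | rfl := hj.lt_or_eq
      · exact hnostore j hj src sa hs
      · exact hu.ne_store src sa (Option.some.inj (hb.symm.trans hs))
  cases hu <;> cases ht
  case val.refl h => exact h.elim
  case loadVal.refl h => exact h.elim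
  case val.op hv =>
    cases hl with | op hI' =>
    rw [resolveAll_eq_evalAll, hI.resolveReg_eq] at hv
    exact ⟨q, .op hI' hv, hdrop rfl⟩
  case loadVal.loadVal hv ha hd =>
    cases hl with | load hI' =>
    rw [resolveAll_eq_evalAll, hI.resolveReg_eq] at hv
    exact ⟨q, .load hI' hv (ha ▸ hd.mem_eq hnostore), hdrop rfl⟩

theorem Ahead.retire_jump (hP : RretFree M P)
    (hA : Ahead M P p C) (hi : minIdx C.buf = i) (hb : C.buf i = some (.jump n)) :
    ∃ q, ArchStep M P ⟨C.reg, C.mem, p⟩ ⟨C.reg, C.mem, q⟩ ∧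
      Ahead M P q ⟨C.reg, C.mem, C.pc, after C.buf i⟩ := by
  obtain ⟨_, _, hI⟩ := hA
  obtain ⟨t, l, q, h', hI, hl, hp, ht⟩ := hI.exists_head hi hb
  cases ht with
  | refl h => exact h.elim
  | br hv hn =>
    cases hl with | br hI' =>
    rw [resolveAll_eq_evalAll, hI.resolveReg_eq] at hv
    exact ⟨_, hn ▸ .br hI' hv, hI.drop_control hP hp hb rfl (by simp)⟩
  | jmpi hv hn =>
    cases hl with | jmpi hI' =>
    rw [resolveAll_eq_evalAll, hI.resolveReg_eq] at hv
    exact ⟨_, hn ▸ .jmpi hI' hv, hI.drop_control hP hp hb rfl (by simp)⟩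

theorem Ahead.retire_fence (hP : RretFree M P)
    (hA : Ahead M P p C) (hi : minIdx C.buf = i) (hb : C.buf i = some .fence) :
    ∃ q, ArchStep M P ⟨C.reg, C.mem, p⟩ ⟨C.reg, C.mem, q⟩ ∧
      Ahead M P q ⟨C.reg, C.mem, C.pc, after C.buf i⟩ := by
  obtain ⟨_, _, hI⟩ := hA
  obtain ⟨t, l, q, h', hI, hl, hp, ht⟩ := hI.exists_head hi hb
  cases ht with | refl =>
  cases hl with | fence hI' =>
  exact ⟨_, .fence hI', hI.drop_control hP hp hb rfl (by simp)⟩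

theorem Ahead.retire_store (hP : RretFree M P)
    (hA : Ahead M P p C) (hi : minIdx C.buf = i)
    (hb : C.buf i = some (.store (.val v) (.resolved (a, lb)))) :
    ∃ q, ArchStep M P ⟨C.reg, C.mem, p⟩ ⟨C.reg, Function.update C.mem a (some v), q⟩ ∧
      Ahead M P q ⟨C.reg, Function.update C.mem a (some v), C.pc, after C.buf i⟩ := by
  obtain ⟨_, _, hI⟩ := hA
  obtain ⟨t, l, q, h', hI, hl, hp, ht⟩ := hI.exists_head hi hb
  obtain ⟨src, args, vs, rfl, hsrc, hvs, rfl⟩ := ht.exists_of_store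
  cases hl with | store hI' =>
  rw [resolve_eq_eval, hI.resolveReg_eq] at hsrc
  rw [resolveAll_eq_evalAll, hI.resolveReg_eq] at hvs
  refine ⟨q, .store hI' hsrc hvs, _, _, InFlight.drop hP hI hp rfl (fun r _ => ?_)
    fun _ _ _ _ hk hd => hd.drop_store hk (fun j hj => ?_) hb⟩
  · rw [resolveReg_succ_of_dest_eq_none hb rfl, hI.resolveReg_eq]
  · simp [hI.eq_none_of_lt j hj]

theorem Ahead.retire_call (hP : RretFree M P)
    {vsp : V × L} (hA : Ahead M P p C) (hi : minIdx C.buf = i) (hb : C.buf i = some .call)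
    (hb₁ : C.buf (i + 1) = some u) (hu : u.IsVal M.rsp vsp)
    (hb₂ : C.buf (i + 2) = some (.store (.val v) (.resolved (a, lb)))) :
    ∃ q, ArchStep M P ⟨C.reg, C.mem, p⟩
        ⟨Function.update C.reg M.rsp (some vsp), Function.update C.mem a (some v), q⟩ ∧
      Ahead M P q ⟨Function.update C.reg M.rsp (some vsp), Function.update C.mem a (some v), C.pc,
        after C.buf (i + 2)⟩ := by
  obtain ⟨_, _, hI⟩ := hA
  obtain ⟨t, l, q, h', hI, hl, hp, ht⟩ := hI.exists_head hi hb
  cases ht with | refl =>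
  cases hl with | @call _ nr hI' =>
  have hρ₁ : resolveReg C.buf C.reg (i + 1) = C.reg :=
    (resolveReg_succ_of_dest_eq_none hb rfl).trans hI.resolveReg_eq
  have hρ₂ : resolveReg C.buf C.reg (i + 2) = Function.update C.reg M.rsp (some vsp) :=
    (resolveReg_succ_of_isVal hb₁ hu).trans (by rw [hρ₁])
  have hρ₃ : resolveReg C.buf C.reg (i + 3) = Function.update C.reg M.rsp (some vsp) :=
    (resolveReg_succ_of_dest_eq_none hb₂ rfl).trans hρ₂
  obtain ⟨w, hw, rfl⟩ := (hI.tracks (k := 1) rfl hb₁).exists_of_op hu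
  rw [hρ₁] at hw
  obtain ⟨hv, ha⟩ : v = (nr, ⊥) ∧ a = M.addr [M.evalOp M.succ (vals [w])] := by
    obtain ⟨src, args, vs, ht, hsrc, hvs, rfl⟩ := (hI.tracks (k := 2) rfl hb₂).exists_of_store
    cases ht
    rw [resolveAll_eq_evalAll, hρ₂, evalAll_singleton_reg] at hvs
    obtain ⟨w', hw', rfl⟩ := hvs
    rw [Function.update_self] at hw'
    obtain rfl := Option.some.inj hw'
    exact ⟨(Option.some.inj hsrc).symm, rfl⟩
  refine ⟨q, ?_, _, _, InFlight.drop (m := i + 2) hP hI hp rfl (fun r _ => by rw [hρ₃])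
    fun _ _ _ _ hk hd => hd.drop_store hk (fun j hj src sa hs => ?_) hb₂⟩
  · rw [ha, hv]
    exact .call hI' hw
  · obtain hj | rfl | rfl : j < i ∨ j = i ∨ j = i + 1 := by omega
    · simp [hI.eq_none_of_lt j hj] at hs
    · simp [hb] at hs
    · exact hu.ne_store src sa (Option.some.inj (hb₁.symm.trans hs))

theorem Ahead.retire_ret (hP : RretFree M P)
    {u₂ : Trans V L R F B} {v₂ : V × L} (hA : Ahead M P p C) (hi : minIdx C.buf = i)
    (hb : C.buf i = some .ret) (hb₁ : C.buf (i + 1) = some u) (hu : u.IsVal M.rret v)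
    (hb₂ : C.buf (i + 2) = some u₂) (hu₂ : u₂.IsVal M.rsp v₂)
    (hb₃ : C.buf (i + 3) = some (.jump n)) :
    ∃ q, ArchStep M P ⟨C.reg, C.mem, p⟩ ⟨Function.update C.reg M.rsp (some v₂), C.mem, q⟩ ∧
      Ahead M P q ⟨Function.update C.reg M.rsp (some v₂), C.mem, C.pc, after C.buf (i + 3)⟩ := by
  obtain ⟨_, _, hI⟩ := hA
  obtain ⟨t, l, q, h', hI, hl, hp, ht⟩ := hI.exists_head hi hb
  cases ht with | refl =>
  obtain ⟨hI', rfl⟩ := hI.eq_ret_block hl hp hb₁ hu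
  have hρ₁ : resolveReg C.buf C.reg (i + 1) = C.reg :=
    (resolveReg_succ_of_dest_eq_none hb rfl).trans hI.resolveReg_eq
  have hρ₂ : resolveReg C.buf C.reg (i + 2) = Function.update C.reg M.rret (some v) :=
    (resolveReg_succ_of_isVal hb₁ hu).trans (by rw [hρ₁])
  have hρ₃ : resolveReg C.buf C.reg (i + 3) =
      Function.update (Function.update C.reg M.rret (some v)) M.rsp (some v₂) :=
    (resolveReg_succ_of_isVal hb₂ hu₂).trans (by rw [hρ₂])
  have hρ₄ := (resolveReg_succ_of_dest_eq_none (ρ := C.reg) hb₃ rfl).trans hρ₃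
  have hnostore : ∀ j ≤ i + 3, ∀ src sa, C.buf j ≠ some (.store src sa) := fun j hj src sa hs => by
    obtain hj | rfl | rfl | rfl | rfl :
      j < i ∨ j = i ∨ j = i + 1 ∨ j = i + 2 ∨ j = i + 3 := by omega
    · simp [hI.eq_none_of_lt j hj] at hs
    · simp [hb] at hs
    · exact hu.ne_store src sa (Option.some.inj (hb₁.symm.trans hs))
    · exact hu₂.ne_store src sa (Option.some.inj (hb₂.symm.trans hs))
    · simp [hb₃] at hs
  obtain ⟨w, dep, hw, hd⟩ := (hI.tracks (k := 1) rfl hb₁).exists_of_load hu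
  obtain ⟨w', hw', rfl⟩ := (hI.tracks (k := 2) rfl hb₂).exists_of_op hu₂
  rw [hρ₁] at hw
  rw [hρ₂, Function.update_of_ne M.rsp_ne_rret] at hw'
  obtain rfl := Option.some.inj (hw.symm.trans hw')
  have hm := hd.mem_eq fun j hj => hnostore j (by omega)
  have hq : q = M.addr (vals [v]) := by
    cases hI.tracks (k := 3) rfl hb₃ with | jmpi hvs hn =>
    rw [resolveAll_eq_evalAll, hρ₃, evalAll_singleton_reg,
      Function.update_of_ne M.rsp_ne_rret.symm, Function.update_self] at hvs
    obtain ⟨_, ⟨⟩, rfl⟩ := hvs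
    exact hn.symm
  refine ⟨q, hq ▸ .ret hI' hw hm, _, _, InFlight.drop (m := i + 3) hP hI hp rfl (fun r hr => ?_)
    fun _ _ _ _ _ hd => hd.drop hnostore⟩
  rw [hρ₄]
  by_cases hrsp : r = M.rsp
  · rw [hrsp, Function.update_self, Function.update_self]
  · simp only [Function.update_of_ne hrsp, Function.update_of_ne hr]

end Retire

section Schedules

variable {V L R F B : Type*} {S S' S'' : State V L R F B} {d : Directive V}
  {D D' : List (Directive V)} {O O' : List (Obs V L)}
  {T T' : State V L R F B → Directive V → List (Obs V L) → State V L R F B → Prop}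

theorem numRetired_cons_of_ne (hd : d ≠ .retire) (D : List (Directive V)) :
    numRetired (d :: D) = numRetired D := by
  cases d <;> first | rfl | exact absurd rfl hd

theorem numRetired_append (D D' : List (Directive V)) :
    numRetired (D ++ D') = numRetired D + numRetired D' := by
  induction D with
  | nil => simp [numRetired]
  | cons d D ih => cases d <;> simp only [List.cons_append, numRetired, ih, Nat.add_right_comm]

theorem Steps.mono (hT : ∀ S d o S', T S d o S' → T' S d o S') (hS : Steps T S D O S') :
    Steps T' S D O S' := by
  induction hS with
  | nil => exact .nil _
  | cons h _ ih => exact .cons (hT _ _ _ _ h) ih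

theorem Steps.append (hS : Steps T S D O S') (hS' : Steps T S' D' O' S'') :
    Steps T S (D ++ D') (O ++ O') S'' := by
  induction hS with
  | nil => exact hS'
  | cons h _ ih => exact List.append_assoc .. ▸ .cons h (ih hS')

end Schedules

section Simulation

variable {V L R F B : Type*} [DecidableEq R] [Lattice L] [OrderBot L]
  {M : Machine V R F B} {P : Program V L R F B} {p n pc : V} {C : Config V L R F B}
  {i i₀ j k : ℕ} {h l : List (Trans V L R F B)} {t u : Trans V L R F B} {r : R}
  {f : F} {c : B} {args : List (Operand V L R)} {vs : List (V × L)} {v : V × L}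

theorem Ahead.fetch (hA : Ahead M P p C) (hl : Fetches M P C.pc l n) :
    Ahead M P p { C with pc := n, buf := insertList C.buf (fresh C.buf) l } := by
  obtain ⟨_, h, hI⟩ := hA
  obtain ⟨i₀, hI, hfresh⟩ := hI.exists_fresh_eq
  have hget (k : ℕ) : insertList C.buf (fresh C.buf) l (i₀ + h.length + k) = l[k]? :=
    hfresh ▸ insertList_add (fun k hk => hI.eq_none_of_le k (hfresh ▸ hk)) k
  refine ⟨i₀, _, hI.take_append le_rfl (by simpa using hI.path.append_fetches hl)
    (fun j hj => insertList_of_lt (hfresh ▸ hj)) (fun j hj => ?_) fun j t hj => ?_⟩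
  · obtain ⟨k, rfl⟩ := Nat.exists_eq_add_of_le hj
    rw [Nat.add_assoc, hget, List.getElem?_eq_none (Nat.le_add_right ..)]
  · exact ⟨t, (hget j).trans hj, hl.tracks (List.mem_of_getElem? hj)⟩

theorem Ahead.execute_op (hA : Ahead M P p C) (hb : C.buf i = some (.op f r args))
    (hv : resolveAll C.buf C.reg i args = some vs) :
    Ahead M P p { C with buf := insert C.buf i (.val r (M.evalOp f (vals vs), lub vs)) } := by
  obtain ⟨_, _, hI⟩ := hA
  refine ⟨_, _, hI.replace_of_not_store hb (fun t ht => ?_) (by simp [Trans.value])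
    (by simp) (by simp)⟩
  cases ht with | refl =>
  exact .op hv

theorem Ahead.execute_br {nt nf : V} (hA : Ahead M P p C)
    (hb : C.buf i = some (.br c args n nt nf)) (hv : resolveAll C.buf C.reg i args = some vs)
    (hn : cond (M.evalCond c (vals vs)) nt nf = n) :
    Ahead M P p { C with buf := insert C.buf i (.jump n) } := by
  obtain ⟨_, _, hI⟩ := hA
  refine ⟨_, _, hI.replace_of_not_store hb (fun t ht => ?_) (by simp [Trans.value])
    (by simp) (by simp)⟩
  cases ht with | refl =>
  exact .br hv hn

theorem Ahead.execute_jmpi (hA : Ahead M P p C) (hb : C.buf i = some (.jmpi args n))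
    (hv : resolveAll C.buf C.reg i args = some vs) (hn : M.addr (vals vs) = n) :
    Ahead M P p { C with buf := insert C.buf i (.jump n) } := by
  obtain ⟨_, _, hI⟩ := hA
  refine ⟨_, _, hI.replace_of_not_store hb (fun t ht => ?_) (by simp [Trans.value])
    (by simp) (by simp)⟩
  cases ht with | refl =>
  exact .jmpi hv hn

theorem Ahead.redirect_br {g nt nf : V} (hA : Ahead M P p C)
    (hb : C.buf i = some (.br c args g nt nf)) (hv : resolveAll C.buf C.reg i args = some vs)
    (hn : cond (M.evalCond c (vals vs)) nt nf = n) :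
    Ahead M P p { C with pc := n, buf := insert (before C.buf i) i (.jump n) } := by
  obtain ⟨_, _, hI⟩ := hA
  obtain ⟨k, _, rfl, hk, ht⟩ := hI.exists_entry hb
  cases ht with | refl =>
  exact ⟨_, _, hI.redirect (List.getElem?_eq_some_iff.mp hk).1.le (hI.path.take_br hk n)
    (by simp [hb]) (.br hv hn)⟩

theorem Ahead.redirect_jmpi {g : V} (hA : Ahead M P p C) (hb : C.buf i = some (.jmpi args g))
    (hv : resolveAll C.buf C.reg i args = some vs) (hn : M.addr (vals vs) = n) :
    Ahead M P p { C with pc := n, buf := insert (before C.buf i) i (.jump n) } := by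
  obtain ⟨_, _, hI⟩ := hA
  obtain ⟨k, _, rfl, hk, ht⟩ := hI.exists_entry hb
  cases ht with | refl =>
  exact ⟨_, _, hI.redirect (List.getElem?_eq_some_iff.mp hk).1.le (hI.path.take_jmpi hk n)
    (by simp [hb]) (.jmpi hv hn)⟩

theorem Ahead.execute_fwd (hA : Ahead M P p C) (hb : C.buf i = some (.load r args pc))
    (hj : j < i) (v : V × L) :
    Ahead M P p { C with buf := insert C.buf i (.loadFwd r args v j pc) } := by
  obtain ⟨_, _, hI⟩ := hA
  refine ⟨_, _, hI.replace_of_not_store hb (fun t ht => ?_) (by simp [Trans.value])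
    (by simp) (by simp)⟩
  cases ht with | refl =>
  exact .loadFwd hj

theorem Ahead.execute_load {dep : WithBot ℕ} (hA : Ahead M P p C) (hb : C.buf i = some u)
    (hu : u = .load r args pc ∨ ∃ j, u = .loadFwd r args v j pc)
    (hv : resolveAll C.buf C.reg i args = some vs)
    (hd : LoadDep C.buf C.mem i (M.addr (vals vs)) v dep) :
    Ahead M P p { C with buf := insert C.buf i (.loadVal r v dep (M.addr (vals vs)) pc) } := by
  obtain ⟨_, _, hI⟩ := hA
  obtain rfl | ⟨j, rfl⟩ := hu
  all_goals
    refine ⟨_, _, hI.replace_of_not_store hb (fun t ht => ?_) (by simp [Trans.value])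
      (by simp) (by simp)⟩
    cases ht
  case refl => exact .loadVal hv rfl hd
  case refl h => exact h.elim
  case loadFwd => exact .loadVal hv rfl hd

theorem Ahead.rollback_loadFwd (hA : Ahead M P p C)
    (hb : C.buf i = some (.loadFwd r args v j pc)) :
    Ahead M P p { C with pc := pc, buf := before C.buf i } := by
  obtain ⟨_, _, hI⟩ := hA
  obtain ⟨k, _, rfl, hk, ht⟩ := hI.exists_entry hb
  cases ht with
  | refl h => exact h.elim
  | loadFwd =>
    exact ⟨_, _, hI.truncate (List.getElem?_eq_some_iff.mp hk).1.le (hI.path.take_load hk)⟩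

theorem Ahead.lt_of_loadFwd (hA : Ahead M P p C) (hb : C.buf i = some (.loadFwd r args v j pc)) :
    j < i := by
  obtain ⟨_, _, hI⟩ := hA
  obtain ⟨_, _, _, _, ht⟩ := hI.exists_entry hb
  cases ht with
  | refl h => exact h.elim
  | loadFwd hj => exact hj

theorem Ahead.rollback_loadVal {dep : WithBot ℕ} {a : V} (hA : Ahead M P p C)
    (hb : C.buf i = some (.loadVal r v dep a pc)) :
    Ahead M P p { C with pc := pc, buf := before C.buf i } := by
  obtain ⟨_, _, hI⟩ := hA
  obtain ⟨k, _, rfl, hk, ht⟩ := hI.exists_entry hb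
  cases ht with
  | refl h => exact h.elim
  | loadVal =>
    exact ⟨_, _, hI.truncate (List.getElem?_eq_some_iff.mp hk).1.le (hI.path.take_load hk)⟩

theorem Ahead.execute_value {src : Operand V L R} {sa : StoreAddr V L R} (hA : Ahead M P p C)
    (hb : C.buf i = some (.store src sa)) (hv : resolve C.buf C.reg i src = some v) :
    Ahead M P p { C with buf := insert C.buf i (.store (.val v) sa) } := by
  obtain ⟨_, _, hI⟩ := hA
  have hval {w : V × L} (h : src = .val w) : w = v := by
    subst h
    exact Option.some.inj hv
  refine ⟨_, _, hI.replace hb (fun t ht => ?_) (by simp [Trans.value])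
    fun k r w dep a pc _ hd => hd.replace hb ?_ ?_⟩
  · cases ht with
    | refl h => exact h.elim
    | store hs ha =>
      refine .store (.inr ⟨v, rfl, ?_⟩) ha
      obtain rfl | ⟨w, hw, hsrc⟩ := hs
      exacts [hv, hval hw ▸ hsrc]
  · rintro w sa ⟨⟩
    rw [hval rfl]
  · rintro b ⟨_, l, ⟨⟩⟩
    exact ⟨src, l, rfl⟩

theorem Ahead.execute_addr {src : Operand V L R} (hA : Ahead M P p C)
    (hb : C.buf i = some (.store src (.pending args)))
    (hv : resolveAll C.buf C.reg i args = some vs)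
    (hk : ∀ k t pc, i < k → C.buf k = some t → ¬ t.Hazard i (M.addr (vals vs)) pc) :
    Ahead M P p
      { C with buf := insert C.buf i (.store src (.resolved (M.addr (vals vs), lub vs))) } := by
  obtain ⟨_, _, hI⟩ := hA
  refine ⟨_, _, hI.replace hb (fun t ht => ?_) (by simp [Trans.value])
    fun k r w dep a pc hbk hd => hd.replace_resolved hb fun hik => hk k _ pc hik hbk⟩
  cases ht with
  | refl h => exact h.elim
  | store hs ha =>
    obtain ha | ⟨_, _, ⟨⟩⟩ := ha
    cases ha
    exact .store hs (.inr ⟨vs, hv, rfl⟩)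

theorem Ahead.rollback_addr {src : Operand V L R} (hA : Ahead M P p C)
    (hb : C.buf i = some (.store src (.pending args)))
    (hv : resolveAll C.buf C.reg i args = some vs) (hik : i < k) (hbk : C.buf k = some t)
    (ht : t.Hazard i (M.addr (vals vs)) pc)
    (hmin : ∀ k' t' pc', i < k' → k' < k → C.buf k' = some t' →
      ¬ t'.Hazard i (M.addr (vals vs)) pc') :
    Ahead M P p ⟨C.reg, C.mem, pc,
      insert (before C.buf k) i (.store src (.resolved (M.addr (vals vs), lub vs)))⟩ := by
  have hA' : Ahead M P p { C with pc := pc, buf := before C.buf k } := by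
    cases ht <;> exact hA.rollback_loadVal hbk
  refine hA'.execute_addr ((before_of_lt hik).trans hb) ?_ fun k' t' pc' hik' hbk' => ?_
  · rw [resolveAll_eq_evalAll] at hv ⊢
    rwa [resolveReg_congr fun j hj => before_of_lt (hj.trans hik)]
  · have hk' : k' < k := not_le.mp fun hkk' => by simp [before_of_le hkk'] at hbk'
    exact hmin k' t' pc' hik' hk' ((before_of_lt hk').symm.trans hbk')

variable [DecidableEq V] {S S' : State V L R F B} {d : Directive V} {o O : List (Obs V L)}
  {D : List (Directive V)} {N : ℕ}

theorem Ahead.step (hA : Ahead M P p S.cfg) (hS : Step M P S d o S') (hd : d ≠ .retire) :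
    S'.cfg.reg = S.cfg.reg ∧ S'.cfg.mem = S.cfg.mem ∧ Ahead M P p S'.cfg := by
  cases hS with
  | simple_fetch hI ht => exact ⟨rfl, rfl, hA.fetch (.of_simple hI ht)⟩
  | cond_fetch b hI => exact ⟨rfl, rfl, hA.fetch (.br hI _)⟩
  | jmpi_fetch n hI => exact ⟨rfl, rfl, hA.fetch (.jmpi hI n)⟩
  | call_fetch hI hi => exact ⟨rfl, rfl, hi ▸ hA.fetch (.call hI)⟩
  | ret_fetch_rsb hI _ hi => exact ⟨rfl, rfl, hi ▸ hA.fetch (.ret hI _)⟩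
  | ret_fetch_rsb_empty n hI _ hi => exact ⟨rfl, rfl, hi ▸ hA.fetch (.ret hI n)⟩
  | op_execute hb _ hv => exact ⟨rfl, rfl, hA.execute_op hb hv⟩
  | cond_execute_correct hb _ hv hn => exact ⟨rfl, rfl, hA.execute_br hb hv hn⟩
  | cond_execute_incorrect hb _ hv hn => exact ⟨rfl, rfl, hA.redirect_br hb hv hn⟩
  | jmpi_execute_correct hb _ hv hn => exact ⟨rfl, rfl, hA.execute_jmpi hb hv hn⟩
  | jmpi_execute_incorrect hb _ hv hn => exact ⟨rfl, rfl, hA.redirect_jmpi hb hv hn⟩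
  | load_execute_nodep hb _ hv ha hs hm =>
    exact ⟨rfl, rfl, ha ▸ hA.execute_load hb (.inl rfl) hv (ha ▸ LoadDep.of_noStore hm hs)⟩
  | load_execute_forward hb _ hv ha hj hbj hs =>
    exact ⟨rfl, rfl, ha ▸ hA.execute_load hb (.inl rfl) hv
      (ha ▸ .forwarded hj hbj (by simp +contextual) hs)⟩
  | load_execute_guess hb _ hj => exact ⟨rfl, rfl, hA.execute_fwd hb hj _⟩
  | load_addr_ok hb _ hv ha hbj hsa hs =>
    exact ⟨rfl, rfl, ha ▸ hA.execute_load hb (.inr ⟨_, rfl⟩) hv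
      (ha ▸ .forwarded (hA.lt_of_loadFwd hb) hbj hsa hs)⟩
  | load_addr_hazard hb => exact ⟨rfl, rfl, hA.rollback_loadFwd hb⟩
  | load_mem_match hb _ hv ha _ hs hm =>
    exact ⟨rfl, rfl, ha ▸ hA.execute_load hb (.inr ⟨_, rfl⟩) hv (ha ▸ LoadDep.of_noStore hm hs)⟩
  | load_mem_hazard hb => exact ⟨rfl, rfl, hA.rollback_loadFwd hb⟩
  | store_execute_value hb _ hv => exact ⟨rfl, rfl, hA.execute_value hb hv⟩
  | store_addr_ok hb _ hv ha hk => exact ⟨rfl, rfl, ha ▸ hA.execute_addr hb hv (ha ▸ hk)⟩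
  | store_addr_hazard hb _ hv ha hik hbk ht hmin =>
    exact ⟨rfl, rfl, ha ▸ hA.rollback_addr hb hv hik hbk (ha ▸ ht) (ha ▸ hmin)⟩
  | _ => exact absurd rfl hd

theorem Ahead.retire (hP : RretFree M P)
    (hA : Ahead M P p S.cfg) (hS : Step M P S .retire o S') :
    ∃ q, ArchStep M P ⟨S.cfg.reg, S.cfg.mem, p⟩ ⟨S'.cfg.reg, S'.cfg.mem, q⟩ ∧
      Ahead M P q S'.cfg := by
  cases hS with
  | value_retire hi hb ht => exact erase_minIdx hi ▸ hA.retire_value hP hi hb ht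
  | jump_retire hi hb => exact erase_minIdx hi ▸ hA.retire_jump hP hi hb
  | fence_retire hi hb => exact erase_minIdx hi ▸ hA.retire_fence hP hi hb
  | store_retire hi hb => exact erase_minIdx hi ▸ hA.retire_store hP hi hb
  | call_retire hi hb hb₁ ht₁ hb₂ => exact hA.retire_call hP hi hb hb₁ ht₁ hb₂
  | ret_retire hi hb hb₁ ht₁ hb₂ ht₂ hb₃ => exact hA.retire_ret hP hi hb hb₁ ht₁ hb₂ ht₂ hb₃

theorem Ahead.exists_archRun (hP : RretFree M P)
    (hA : Ahead M P p S.cfg) (hS : Steps (Step M P) S D O S') :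
    ∃ q, ArchRun M P (numRetired D) ⟨S.cfg.reg, S.cfg.mem, p⟩ ⟨S'.cfg.reg, S'.cfg.mem, q⟩ ∧
      Ahead M P q S'.cfg := by
  induction hS generalizing p with
  | nil => exact ⟨p, .zero _, hA⟩
  | @cons _ _ _ d _ _ _ hstep _ ih =>
    by_cases hd : d = .retire
    · obtain rfl := hd
      obtain ⟨p', hp', hA'⟩ := hA.retire hP hstep
      obtain ⟨q, hrun, hq⟩ := ih hA'
      exact ⟨q, .succ hp' hrun, hq⟩
    · obtain ⟨hreg, hmem, hA'⟩ := hA.step hstep hd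
      rw [numRetired_cons_of_ne hd, ← hreg, ← hmem]
      exact ih hA'

theorem BigStep.exists_archRun (hP : RretFree M P)
    (hS : BigStep M P N S D O S') (hC : S.cfg.Terminal) :
    ∃ q, ArchRun M P N S.cfg.arch ⟨S'.cfg.reg, S'.cfg.mem, q⟩ ∧
      (S'.cfg.Terminal → S'.cfg.pc = q) := by
  obtain ⟨hS, rfl⟩ := hS
  obtain ⟨q, hrun, _, _, hI⟩ := Ahead.exists_archRun hP ⟨0, [], .of_terminal hC 0⟩ hS
  exact ⟨q, hrun, hI.pc_eq_of_terminal⟩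

theorem SeqBigStep.archRun (hP : RretFree M P)
    (hS : SeqBigStep M P N S O S') : ArchRun M P N S.cfg.arch S'.cfg.arch := by
  obtain ⟨hC, hC', D, hD, hN⟩ := hS
  obtain ⟨q, hrun, hq⟩ := BigStep.exists_archRun hP
    ⟨hD.mono fun _ _ _ _ hstep => hstep.1, hN⟩ hC
  obtain rfl := hq hC'
  exact hrun

end Simulation

section OfList

variable {V L R F B : Type*}

/-- The reorder buffer with the entries `l` at the indices from `1` on, where a fetch into the empty
buffer puts them. -/
def ofList (l : List (Trans V L R F B)) : Buf V L R F B := insertList (fun _ => none) 1 l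

variable {l l' : List (Trans V L R F B)} {t u : Trans V L R F B} {i k : ℕ}

@[simp]
theorem ofList_zero : ofList l 0 = none := insertList_of_lt one_pos

@[simp]
theorem ofList_succ : ofList l (i + 1) = l[i]? :=
  Nat.add_comm 1 i ▸ insertList_add (fun _ _ => rfl) i

theorem ofList_of_lt (h : l.length < k) : ofList l k = none := by
  obtain ⟨k, rfl⟩ := Nat.exists_eq_succ_of_ne_zero (Nat.ne_zero_of_lt h)
  exact ofList_succ.trans (List.getElem?_eq_none (Nat.lt_succ_iff.mp h))

theorem fresh_ofList_nil : fresh (ofList ([] : List (Trans V L R F B))) = 1 :=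
  fresh_of_forall_eq_none fun _ => rfl

theorem insert_fresh_ofList_nil :
    insert (ofList []) (fresh (ofList ([] : List (Trans V L R F B)))) t = ofList [t] := by
  rw [fresh_ofList_nil]
  rfl

theorem minIdx_ofList_cons : minIdx (ofList (t :: l)) = 1 :=
  minIdx_eq_of_forall_lt (by simp) (by simp)

theorem after_ofList (h : l.length ≤ k) : after (ofList l) k = ofList [] := by
  funext j
  obtain hj | hj := le_or_gt j k
  · exact after_of_le hj
  · exact (after_of_lt hj).trans (ofList_of_lt (h.trans_lt hj))

theorem erase_ofList_singleton : erase (ofList [t]) 1 = ofList [] :=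
  (erase_minIdx minIdx_ofList_cons).trans (after_ofList le_rfl)

theorem insert_ofList (h : i < l.length) : insert (ofList l) (i + 1) u = ofList (l.set i u) := by
  funext j
  rcases j with _ | j
  · exact (insert_of_ne (by simp)).trans (by simp)
  · obtain rfl | hj := eq_or_ne j i
    · simp [h]
    · rw [insert_of_ne (by simpa using hj), ofList_succ, ofList_succ, List.getElem?_set_ne hj.symm]

theorem insert_before_ofList_append :
    insert (before (ofList (l ++ l')) (l.length + 1)) (l.length + 1) u = ofList (l ++ [u]) := by
  funext j
  rcases j with _ | j
  · exact (insert_of_ne (by simp)).trans ((before_of_lt (by simp)).trans (by simp))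
  · obtain hj | rfl | hj := lt_trichotomy j l.length
    · rw [insert_of_ne (by omega), before_of_lt (by omega), ofList_succ, ofList_succ,
        List.getElem?_append_left hj, List.getElem?_append_left hj]
    · simp
    · rw [insert_of_ne (by omega), before_of_le (by omega), ofList_of_lt (by simpa using hj)]

theorem noFence_ofList (h : ∀ t ∈ l.take i, t ≠ .fence) : NoFence (ofList l) (i + 1) := by
  rintro (_ | j) hj hb
  · simp at hb
  · rw [ofList_succ] at hb
    refine h _ (List.mem_of_getElem? (i := j) ?_) rfl
    rwa [List.getElem?_take_of_lt (Nat.lt_of_succ_lt_succ hj)]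

theorem noStore_ofList {a : V} {lo : ℕ} (h : ∀ t ∈ l.take i, ¬ t.StoresTo a) :
    NoStore (ofList l) a lo (i + 1) := by
  rintro (_ | j) t _ hj hb
  · simp at hb
  · rw [ofList_succ] at hb
    refine h t (List.mem_of_getElem? (i := j) ?_)
    rwa [List.getElem?_take_of_lt (Nat.lt_of_succ_lt_succ hj)]

theorem resolve_ofList_one [DecidableEq R] {ρ : R → Option (V × L)} {x : Operand V L R} :
    resolve (ofList l) ρ 1 x = x.eval ρ := by
  rw [resolve_eq_eval, resolveReg_of_none (by simp)]

theorem resolveAll_ofList_one [DecidableEq R] {ρ : R → Option (V × L)}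
    {args : List (Operand V L R)} : resolveAll (ofList l) ρ 1 args = evalAll ρ args :=
  congrArg (List.mapM · args) (funext fun _ => resolve_ofList_one)

end OfList

section Existence

variable {V L R F B : Type*} [DecidableEq V] [DecidableEq R] [Lattice L] [OrderBot L]

/-- Reachability by a sequence of sequential steps that retires `N` instructions. -/
def SeqReach (M : Machine V R F B) (P : Program V L R F B) (N : ℕ)
    (S S' : State V L R F B) : Prop :=
  ∃ D O, Steps (SeqStep M P) S D O S' ∧ numRetired D = N

variable {M : Machine V R F B} {P : Program V L R F B} {N N' : ℕ} {S S' S'' : State V L R F B}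
  {d : Directive V} {o : List (Obs V L)} {ρ : R → Option (V × L)} {μ : V → Option (V × L)}
  {n p : V} {buf buf' : Buf V L R F B} {σ σ' : Rsb V} {a b : ArchState V L R}

namespace SeqReach

theorem refl (S : State V L R F B) : SeqReach M P 0 S S := ⟨[], [], .nil S, rfl⟩

theorem trans (h : SeqReach M P N S S') (h' : SeqReach M P N' S' S'') :
    SeqReach M P (N + N') S S'' := by
  obtain ⟨D, O, hD, rfl⟩ := h
  obtain ⟨D', O', hD', rfl⟩ := h'
  exact ⟨_, _, hD.append hD', numRetired_append D D'⟩

theorem head (h : SeqReach M P 0 S S') (h' : SeqReach M P N S' S'') : SeqReach M P N S S'' :=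
  Nat.zero_add N ▸ h.trans h'

theorem fetch (h : Step M P ⟨⟨ρ, μ, p, ofList []⟩, σ⟩ d o ⟨⟨ρ, μ, n, buf⟩, σ'⟩) (hd : d ≠ .retire)
    (hbuf : buf = buf') (h' : SeqReach M P N ⟨⟨ρ, μ, n, buf'⟩, σ'⟩ S') :
    SeqReach M P N ⟨⟨ρ, μ, p, ofList []⟩, σ⟩ S' := by
  obtain rfl := hbuf
  obtain ⟨D, O, hD, rfl⟩ := h'
  exact ⟨_, _, .cons ⟨h, fun _ _ => rfl⟩ hD, numRetired_cons_of_ne hd D⟩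

theorem execute (h : Step M P S d o ⟨⟨ρ, μ, n, buf⟩, σ⟩) (hd : ¬ d.IsFetch ∧ d ≠ .retire)
    (hbuf : buf = buf') (h' : SeqReach M P N ⟨⟨ρ, μ, n, buf'⟩, σ⟩ S') : SeqReach M P N S S' := by
  obtain rfl := hbuf
  obtain ⟨D, O, hD, rfl⟩ := h'
  exact ⟨_, _, .cons ⟨h, fun hf => absurd hf hd.1⟩ hD, numRetired_cons_of_ne hd.2 D⟩

theorem retire (h : Step M P S .retire o ⟨⟨ρ, μ, n, buf⟩, σ⟩) (hbuf : buf = buf') :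
    SeqReach M P 1 S ⟨⟨ρ, μ, n, buf'⟩, σ⟩ := by
  obtain rfl := hbuf
  exact ⟨_, _, .cons ⟨h, False.elim⟩ (.nil _), rfl⟩

theorem exists_jmpi {l : List (Trans V L R F B)} {args : List (Operand V L R)} {g : V}
    {vs : List (V × L)} (hf : ∀ t ∈ l, t ≠ .fence)
    (hv : resolveAll (ofList (l ++ [.jmpi args g])) ρ (l.length + 1) args = some vs) (σ : Rsb V) :
    ∃ σ', SeqReach M P 0 ⟨⟨ρ, μ, g, ofList (l ++ [.jmpi args g])⟩, σ⟩
      ⟨⟨ρ, μ, M.addr (vals vs), ofList (l ++ [.jump (M.addr (vals vs))])⟩, σ'⟩ := by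
  have hb : ofList (l ++ [.jmpi args g]) (l.length + 1) = some (.jmpi args g) := by simp
  have hf' : NoFence (ofList (l ++ [.jmpi args g])) (l.length + 1) :=
    noFence_ofList (by simpa using hf)
  by_cases hg : M.addr (vals vs) = g
  · subst hg
    exact ⟨σ, .execute (.jmpi_execute_correct hb hf' hv rfl) ⟨id, nofun⟩
      ((insert_ofList (by simp)).trans (by simp)) (.refl _)⟩
  · exact ⟨_, .execute (.jmpi_execute_incorrect hb hf' hv rfl hg) ⟨id, nofun⟩
      insert_before_ofList_append (.refl _)⟩

end SeqReach

/-- The state between two instructions of a sequential execution: no instruction is in flight. -/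
def ArchState.idle (F B : Type*) (a : ArchState V L R) (σ : Rsb V) : State V L R F B :=
  ⟨⟨a.reg, a.mem, a.pc, ofList []⟩, σ⟩

theorem exists_seqReach_call {nf nr : V} {v : V × L} (hI : P p = some (.call nf nr))
    (hr : ρ M.rsp = some v) (σ : Rsb V) :
    ∃ σ', SeqReach M P 1 (ArchState.idle F B ⟨ρ, μ, p⟩ σ) (ArchState.idle F B
      ⟨Function.update ρ M.rsp (some (M.evalOp M.succ (vals [v]), lub [v])),
        Function.update μ (M.addr [M.evalOp M.succ (vals [v])]) (some (nr, ⊥)), nf⟩ σ') := by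
  refine ⟨insert σ 1 (.push nr), .fetch (.call_fetch hI fresh_ofList_nil.symm) nofun
    (buf' := ofList [.call, .op M.succ M.rsp [.reg M.rsp],
      .store (.val (nr, ⊥)) (.pending [.reg M.rsp])]) rfl ?_⟩
  refine .execute (.op_execute (i := 2) (vs := [v]) rfl (noFence_ofList (by simp)) ?_) ⟨id, nofun⟩
    (insert_ofList (by simp)) ?_
  · rw [resolveAll_eq_evalAll, evalAll_singleton_reg]
    exact ⟨v, by simp [resolveReg, Trans.dest, hr], rfl⟩
  refine .execute (.store_addr_ok (i := 3) (vs := [(M.evalOp M.succ (vals [v]), lub [v])]) rfl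
    (noFence_ofList (by simp)) ?_ rfl ?_) ⟨id, nofun⟩ (insert_ofList (by simp)) ?_
  · rw [resolveAll_eq_evalAll, evalAll_singleton_reg]
    exact ⟨_, by simp [resolveReg, Trans.dest, Trans.value], rfl⟩
  · intro k t pc hk hb
    rw [ofList_of_lt (by simpa using hk)] at hb
    cases hb
  exact .retire (.call_retire minIdx_ofList_cons rfl rfl .val rfl) (after_ofList le_rfl)

theorem exists_seqReach_fetch_ret (hI : P p = some .ret) (σ : Rsb V) :
    ∃ g σ', SeqReach M P 0 ⟨⟨ρ, μ, p, ofList []⟩, σ⟩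
      ⟨⟨ρ, μ, g, ofList [.ret, .load M.rret [.reg M.rsp] p, .op M.pred M.rsp [.reg M.rsp],
        .jmpi [.reg M.rret] g]⟩, σ'⟩ := by
  cases htop : Rsb.top σ with
  | none => exact ⟨p, _, .fetch (.ret_fetch_rsb_empty p hI htop fresh_ofList_nil.symm) nofun rfl
      (.refl _)⟩
  | some g =>
    exact ⟨g, _, .fetch (.ret_fetch_rsb hI htop fresh_ofList_nil.symm) nofun rfl (.refl _)⟩

theorem exists_seqReach_ret {v w : V × L} (hI : P p = some .ret) (hr : ρ M.rsp = some v)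
    (hm : μ (M.addr (vals [v])) = some w) (σ : Rsb V) :
    ∃ σ', SeqReach M P 1 (ArchState.idle F B ⟨ρ, μ, p⟩ σ) (ArchState.idle F B
      ⟨Function.update ρ M.rsp (some (M.evalOp M.pred (vals [v]), lub [v])), μ,
        M.addr (vals [w])⟩ σ') := by
  obtain ⟨g, σ₁, hfetch⟩ := exists_seqReach_fetch_ret (M := M) (ρ := ρ) (μ := μ) hI σ
  obtain ⟨σ₂, hjmpi⟩ := SeqReach.exists_jmpi (M := M) (P := P) (ρ := ρ) (μ := μ) (g := g)
    (l := [.ret, .loadVal M.rret w ⊥ (M.addr (vals [v])) p,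
      .val M.rsp (M.evalOp M.pred (vals [v]), lub [v])]) (args := [.reg M.rret]) (vs := [w])
    (by simp) (by
      rw [resolveAll_eq_evalAll, evalAll_singleton_reg]
      exact ⟨w, by simp [resolveReg, Trans.dest, Trans.value, M.rsp_ne_rret], rfl⟩) σ₁
  refine ⟨σ₂, hfetch.head ?_⟩
  refine .execute (.load_execute_nodep (i := 2) (vs := [v]) rfl (noFence_ofList (by simp)) ?_ rfl
    (noStore_ofList (by simp [Trans.StoresTo])) hm) ⟨id, nofun⟩ (insert_ofList (by simp)) ?_
  · rw [resolveAll_eq_evalAll, evalAll_singleton_reg]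
    exact ⟨v, by simp [resolveReg, Trans.dest, hr], rfl⟩
  refine .execute (.op_execute (i := 3) (vs := [v]) rfl (noFence_ofList (by simp)) ?_) ⟨id, nofun⟩
    (insert_ofList (by simp)) ?_
  · rw [resolveAll_eq_evalAll, evalAll_singleton_reg]
    exact ⟨v, by simp [resolveReg, Trans.dest, M.rsp_ne_rret.symm, hr], rfl⟩
  exact hjmpi.head (.retire (.ret_retire minIdx_ofList_cons rfl rfl (.loadVal _ _ _) rfl
    .val rfl) (after_ofList le_rfl))

theorem ArchStep.exists_seqReach (h : ArchStep M P a b) (σ : Rsb V) :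
    ∃ σ', SeqReach M P 1 (a.idle F B σ) (b.idle F B σ') := by
  have hfence (t : Trans V L R F B) : NoFence (ofList [t]) 1 := noFence_ofList (by simp)
  have hset {t u : Trans V L R F B} : insert (ofList [t]) 1 u = ofList [u] :=
    insert_ofList Nat.one_pos
  cases h with
  | op hI hv =>
    exact ⟨σ, .fetch (.simple_fetch hI rfl) nofun insert_fresh_ofList_nil <|
      .execute (.op_execute rfl (hfence _) (resolveAll_ofList_one.trans hv)) ⟨id, nofun⟩ hset <|
      .retire (.value_retire minIdx_ofList_cons rfl .val) erase_ofList_singleton⟩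
  | br hI hv =>
    exact ⟨σ, .fetch (.cond_fetch _ hI) nofun insert_fresh_ofList_nil <|
      .execute (.cond_execute_correct rfl (hfence _) (resolveAll_ofList_one.trans hv) rfl)
        ⟨id, nofun⟩ hset <|
      .retire (.jump_retire minIdx_ofList_cons rfl) erase_ofList_singleton⟩
  | load hI hv hm =>
    exact ⟨σ, .fetch (.simple_fetch hI rfl) nofun insert_fresh_ofList_nil <|
      .execute (.load_execute_nodep rfl (hfence _) (resolveAll_ofList_one.trans hv) rfl
        (noStore_ofList (by simp)) hm) ⟨id, nofun⟩ hset <|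
      .retire (.value_retire minIdx_ofList_cons rfl (.loadVal _ _ _)) erase_ofList_singleton⟩
  | store hI hs hv =>
    exact ⟨σ, .fetch (.simple_fetch hI rfl) nofun insert_fresh_ofList_nil <|
      .execute (.store_execute_value rfl (hfence _) (resolve_ofList_one.trans hs))
        ⟨id, nofun⟩ hset <|
      .execute (.store_addr_ok rfl (hfence _) (resolveAll_ofList_one.trans hv) rfl
        fun k t pc hk hb => absurd (hb.symm.trans (ofList_of_lt hk)) nofun) ⟨id, nofun⟩ hset <|
      .retire (.store_retire minIdx_ofList_cons rfl) erase_ofList_singleton⟩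
  | jmpi hI hv =>
    exact ⟨σ, .fetch (.jmpi_fetch _ hI) nofun insert_fresh_ofList_nil <|
      .execute (.jmpi_execute_correct rfl (hfence _) (resolveAll_ofList_one.trans hv) rfl)
        ⟨id, nofun⟩ hset <|
      .retire (.jump_retire minIdx_ofList_cons rfl) erase_ofList_singleton⟩
  | call hI hr => exact exists_seqReach_call hI hr σ
  | ret hI hr hm => exact exists_seqReach_ret hI hr hm σ
  | fence hI =>
    exact ⟨σ, .fetch (.simple_fetch hI rfl) nofun insert_fresh_ofList_nil <|
      .retire (.fence_retire minIdx_ofList_cons rfl) erase_ofList_singleton⟩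

theorem ArchRun.exists_seqReach (h : ArchRun M P N a b) (σ : Rsb V) :
    ∃ σ', SeqReach M P N (a.idle F B σ) (b.idle F B σ') := by
  induction h generalizing σ with
  | zero => exact ⟨σ, .refl _⟩
  | succ h _ ih =>
    obtain ⟨σ₁, h₁⟩ := h.exists_seqReach σ
    obtain ⟨σ₂, h₂⟩ := ih σ₁
    exact ⟨σ₂, Nat.add_comm 1 _ ▸ h₁.trans h₂⟩

theorem ArchRun.exists_seqBigStep {C : Config V L R F B} (h : ArchRun M P N C.arch b)
    (hC : C.Terminal) (σ : Rsb V) :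
    ∃ σ' O, SeqBigStep M P N ⟨C, σ⟩ O (b.idle F B σ') := by
  obtain ⟨σ', D, O, hD⟩ := h.exists_seqReach (F := F) (B := B) σ
  have hidle : C.arch.idle F B σ = ⟨C, σ⟩ := by
    rw [ArchState.idle, ← show C.buf = ofList [] from funext hC]
    rfl
  exact ⟨σ', O, hC, fun _ => rfl, D, hidle ▸ hD⟩

end Existence

end Speculative

open Speculative in
theorem theorem1_general {V L R F B : Type*} [DecidableEq V] [DecidableEq R] [Lattice L]
    [OrderBot L]
    (M : Machine V R F B) (P : Program V L R F B)
    (hP : ∀ n I, P n = some I → Operand.reg M.rret ∉ I.operands)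
    (N : ℕ) (C C₁ : Config V L R F B) (σ σ₁ : Rsb V)
    (D : List (Directive V)) (O₁ : List (Obs V L))
    (hC : C.Terminal) (hD : BigStep M P N ⟨C, σ⟩ D O₁ ⟨C₁, σ₁⟩) :
    (∃ C₂ σ₂ O₂, SeqBigStep M P N ⟨C, σ⟩ O₂ ⟨C₂, σ₂⟩) ∧
    ∀ C₂ σ₂ O₂, SeqBigStep M P N ⟨C, σ⟩ O₂ ⟨C₂, σ₂⟩ →
      C₁.Equiv C₂ ∧ (C₁.Terminal → C₁ = C₂) := by
  obtain ⟨q, hrun, hpc⟩ := hD.exists_archRun hP hC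
  refine ⟨?_, fun C₂ σ₂ O₂ hseq => ?_⟩
  · obtain ⟨σ₂, O₂, hseq⟩ := hrun.exists_seqBigStep hC σ
    exact ⟨_, σ₂, O₂, hseq⟩
  · have heq : ⟨C₁.reg, C₁.mem, q⟩ = C₂.arch := hrun.deterministic (hseq.archRun hP)
    refine ⟨⟨congrArg ArchState.reg heq, congrArg ArchState.mem heq⟩, fun hC₁ => ?_⟩
    obtain rfl : C₁.pc = q := hpc hC₁
    exact Config.eq_of_arch_eq hC₁ hseq.2.1 heq

open Speculative in
theorem theorem1 {V L R F B : Type*} [DecidableEq V] [DecidableEq R] [Lattice L] [OrderBot L]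
    [Finite R]
    (M : Machine V R F B) (P : Program V L R F B)
    (hP : ∀ n I, P n = some I → Operand.reg M.rret ∉ I.operands)
    (N : ℕ) (C C₁ : Config V L R F B) (σ σ₁ : Rsb V)
    (D : List (Directive V)) (O₁ : List (Obs V L))
    (hC : C.Terminal) (hD : BigStep M P N ⟨C, σ⟩ D O₁ ⟨C₁, σ₁⟩) :
    (∃ C₂ σ₂ O₂, SeqBigStep M P N ⟨C, σ⟩ O₂ ⟨C₂, σ₂⟩) ∧
    ∀ C₂ σ₂ O₂, SeqBigStep M P N ⟨C, σ⟩ O₂ ⟨C₂, σ₂⟩ →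
      C₁.Equiv C₂ ∧ (C₁.Terminal → C₁ = C₂) :=
  theorem1_general M P hP N C C₁ σ σ₁ D O₁ hC hD
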